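/- Let $k$ be an algebraically closed field of characteristic $0$, and let $G$ be a nontrivial finite subgroup of the rank one Cremona group $\mathrm{Cr}_1=\mathrm{PSL}_2(k)=\mathrm{Aut}(\mathbf P^1)$. Then $G$ is isomorphic to one of the following groups: the rotation group of a regular tetrahedron, octahedron or icosahedron (that is, $\mathrm A_4$, $\mathrm S_4$ or $\mathrm A_5$), a dihedral group of order $2\ell\ge 4$, or a cyclic group of order $\ell\ge 2$; and the following formal power series $S_G(t)=\sum_{n\ge 0}s_nt^n\in\mathbf Z[[t]]$ is well defined by the type of $G$: (a) if $G$ is a rotation group of a tetrahedron, octahedron or icosahedron, then, with $a=3$, $4$ or $6$ respectively, $$S_G(t)=t^{2a-1}\bigl(1+t^{4a-6}\bigr)\sum_{n\ge 0}t^{2na}\sum_{n\ge 0}t^{(4a-4)n}+t^{4a-5}\sum_{n\ge 0}t^{(4a-4)n};$$ (b) if $G$ is a dihedral group of order $2\ell\ge 4$ or a cyclic group of order $\ell\ge 2$, then $$S_G(t)=\sum_{n\ge 0}t^{2\ell(n+1)-1}.$$ Let $\widetilde G\subset\mathrm{SL}_2(k)$ be the full preimage of $G$ under the canonical homomorphism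 $\mathrm{SL}_2(k)\to\mathrm{PSL}_2(k)$, acting linearly on the affine plane $\mathbf A^2$, and let $\pi\colon\mathbf A^2\setminus\{0\}\to\mathbf P^1$ be the natural projection. For every $d$ with $s_d\ne 0$ there is a dominant $\widetilde G$-equivariant map $\widetilde\varphi=(\widetilde\varphi_1,\widetilde\varphi_2)\colon\mathbf A^2\to\mathbf A^2$ whose components $\widetilde\varphi_1,\widetilde\varphi_2\in k[x_1,x_2]$ are homogeneous of degree $d$ (a polynomial homogeneous self-compression of $\widetilde G$ of degree $d$), such that its descent, i.e. the morphism $\varphi\colon\mathbf P^1\to\mathbf P^1$ with $\varphi(\pi(v))=\pi(\widetilde\varphi(v))$ whenever $v\neq 0$ and $\widetilde\varphi(v)\ne 0$, is a nontrivial self-compression of $G$: it is dominant, $G$-equivariant, and not a birational isomorphism. Moreover, $s_d\neq 0$ for infinitely many $d$. -/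

import Mathlib

namespace CremonaOne

open scoped LinearAlgebra.Projectivization PowerSeries

/-! Over an algebraically closed field, varieties are treated classically, through their points. -/

/-- The points of the projective line over `k`. -/
abbrev P1 (k : Type*) [Field k] : Type _ := ℙ k (Fin 2 → k)

/-- The group `SL_2` over `k`. -/
abbrev SL2 (k : Type*) [Field k] : Type _ := Matrix.SpecialLinearGroup (Fin 2) k

/-- The group `PSL_2` over `k`: the quotient of `SL_2` by its centre. It acts on the projective
line by fractional linear transformations; this identifies it with the automorphism group of the
projective line, which is the Cremona group of rank one. -/
abbrev PSL2 (k : Type*) [Field k] : Type _ := Matrix.ProjectiveSpecialLinearGroup (Fin 2) k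

section Series

/-- The formal power series `∑_{n ≥ 0} t ^ (e n)`, for a function `e` with finite fibres: the
coefficient of `t ^ m` is the number of `n` with `e n = m`. -/
noncomputable def powerSum (e : ℕ → ℕ) : ℤ⟦X⟧ :=
  PowerSeries.mk fun m => (({n : ℕ | e n = m}.ncard : ℕ) : ℤ)

/-- `t^(2a-1) (1 + t^(4a-6)) ∑ t^(2na) ∑ t^((4a-4)n) + t^(4a-5) ∑ t^((4a-4)n)`
(used for `a = 3, 4, 6`). -/
noncomputable def polyhedralSeries (a : ℕ) : ℤ⟦X⟧ :=
  PowerSeries.X ^ (2 * a - 1) * (1 + PowerSeries.X ^ (4 * a - 6))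
      * powerSum (fun n => 2 * n * a) * powerSum (fun n => (4 * a - 4) * n)
    + PowerSeries.X ^ (4 * a - 5) * powerSum (fun n => (4 * a - 4) * n)

/-- `∑ t^(2ℓ(n+1)-1)` (used for `ℓ ≥ 2`). -/
noncomputable def dihedralSeries (l : ℕ) : ℤ⟦X⟧ :=
  powerSum fun n => 2 * l * (n + 1) - 1

/-- `IsSeriesOf G S` says that `S` is the power series `S_G` associated with the group `G`,
according to the type of `G`. The rotation groups of the regular tetrahedron, octahedron and
icosahedron are, as abstract groups, the alternating group on four letters, the symmetric group on
four letters and the alternating group on five letters. -/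
inductive IsSeriesOf {H : Type*} [Group H] (G : Subgroup H) : ℤ⟦X⟧ → Prop
  | tetrahedral (h : Nonempty (G ≃* alternatingGroup (Fin 4))) :
      IsSeriesOf G (polyhedralSeries 3)
  | octahedral (h : Nonempty (G ≃* Equiv.Perm (Fin 4))) :
      IsSeriesOf G (polyhedralSeries 4)
  | icosahedral (h : Nonempty (G ≃* alternatingGroup (Fin 5))) :
      IsSeriesOf G (polyhedralSeries 6)
  | dihedral (l : ℕ) (hl : 2 ≤ l) (h : Nonempty (G ≃* DihedralGroup l)) :
      IsSeriesOf G (dihedralSeries l)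
  | cyclic (l : ℕ) (hl : 2 ≤ l) (h : IsCyclic G) (hcard : Nat.card G = l) :
      IsSeriesOf G (dihedralSeries l)

end Series

section Maps

variable {k : Type*} [Field k]

/-- The full preimage in `SL_2` of a subgroup of `PSL_2`. -/
def binaryGroup (G : Subgroup (PSL2 k)) : Subgroup (SL2 k) :=
  G.comap (QuotientGroup.mk' (Subgroup.center (SL2 k)))

/-- The self-map of `k ^ 2` (the points of the affine plane) given by a pair of polynomials. -/
noncomputable def polyMap (F : Fin 2 → MvPolynomial (Fin 2) k) (v : Fin 2 → k) : Fin 2 → k :=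
  fun i => MvPolynomial.eval v (F i)

/-- The pair of polynomials `F` defines a polynomial homogeneous self-compression of degree `d` of
the linear group `H` acting on the affine plane: both components are forms of degree `d`, the map
is equivariant, and it is dominant, that is, the Zariski closure of its image is the plane. -/
structure IsHomogeneousSelfCompression (H : Subgroup (SL2 k)) (d : ℕ)
    (F : Fin 2 → MvPolynomial (Fin 2) k) : Prop where
  homogeneous : ∀ i, (F i).IsHomogeneous d
  equivariant : ∀ g ∈ H, ∀ v : Fin 2 → k, polyMap F (g • v) = g • polyMap F v
  dominant : MvPolynomial.zeroLocus k
    (MvPolynomial.vanishingIdeal k (Set.range (polyMap F))) = Set.univ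

/-- Zariski open subsets of the projective line: complements of zero loci of sets of forms. -/
def IsZariskiOpen (U : Set (P1 k)) : Prop :=
  ∃ S : Set (MvPolynomial (Fin 2) k), (∀ F ∈ S, ∃ n : ℕ, F.IsHomogeneous n) ∧
    ∀ (v : Fin 2 → k) (hv : v ≠ 0),
      Projectivization.mk k v hv ∈ U ↔ ∃ F ∈ S, MvPolynomial.eval v F ≠ 0

/-- The map `f` from the projective line to itself is regular on the set `U`: near every point
of `U` it is given by two forms of the same degree without common zeros. -/
def IsRegularOn (f : P1 k → P1 k) (U : Set (P1 k)) : Prop :=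
  ∀ p ∈ U, ∃ W : Set (P1 k), IsZariskiOpen W ∧ p ∈ W ∧ W ⊆ U ∧
    ∃ (e : ℕ) (F : Fin 2 → MvPolynomial (Fin 2) k), (∀ i, (F i).IsHomogeneous e) ∧
      ∀ (v : Fin 2 → k) (hv : v ≠ 0), Projectivization.mk k v hv ∈ W →
        ∃ hF : polyMap F v ≠ 0,
          f (Projectivization.mk k v hv) = Projectivization.mk k (polyMap F v) hF

/-- The map `f` restricts to an isomorphism between nonempty Zariski open subsets of the
projective line. -/
def IsBirationalIso (f : P1 k → P1 k) : Prop :=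
  ∃ U V : Set (P1 k), IsZariskiOpen U ∧ U.Nonempty ∧ IsZariskiOpen V ∧ V.Nonempty ∧
    ∃ g : P1 k → P1 k, IsRegularOn f U ∧ IsRegularOn g V ∧
      Set.MapsTo f U V ∧ Set.MapsTo g V U ∧ Set.InvOn g f U V

/-- The map `f` is a self-compression of the group `G` of automorphisms of the projective line:
a dominant `G`-equivariant morphism. -/
structure IsSelfCompression (G : Subgroup (PSL2 k)) (f : P1 k → P1 k) : Prop where
  regular : IsRegularOn f Set.univ
  dominant : ∀ U : Set (P1 k), IsZariskiOpen U → U.Nonempty → ∃ p, f p ∈ U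
  equivariant : ∀ g ∈ G, ∀ p : P1 k, f (g • p) = g • f p

/-- A self-compression of a group of automorphisms of the projective line is nontrivial if it is
not a birational isomorphism. -/
structure IsNontrivialSelfCompression (G : Subgroup (PSL2 k)) (f : P1 k → P1 k) : Prop
    extends IsSelfCompression G f where
  not_birational : ¬ IsBirationalIso f

/-- `f` is the descent to the projective line of the map of the plane defined by `F`: one has
`f ∘ π = π ∘ F` wherever the right hand side is defined, `π` being the natural projection of the
punctured plane to the projective line. -/
def IsDescent (F : Fin 2 → MvPolynomial (Fin 2) k) (f : P1 k → P1 k) : Prop :=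
  ∀ (v : Fin 2 → k) (hv : v ≠ 0) (hF : polyMap F v ≠ 0),
    f (Projectivization.mk k v hv) = Projectivization.mk k (polyMap F v) hF

end Maps

end CremonaOne

/-! Invariants produce equivariant maps. If a form f of degree d + 1 is invariant under the binary
group, then (∂f/∂x₁, −∂f/∂x₀) is an equivariant pair of forms of degree d, because elements of SL₂
preserve the symplectic form that identifies gradients with vectors (`polyMap_hamiltonian_smul`).
Removing the greatest common divisor leaves a pair without common zeros, of some degree e, and this
pair defines the descent (`exists_factorization`). If e ≥ 2, a general fibre of the descent has more
than one point in characteristic zero, so the descent is not birational (`not_injOn_descent`);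
`compression_of_factorization` collects these facts.

Two arguments give e ≥ 2. For a polyhedral group, the fixed points of the descent are the zeros of a
form of degree e + 1, nonzero by Euler's identity; if e ≤ 1, they would contain an orbit of length
at most two, and there is none (`compression_of_invariant`). For a cyclic or dihedral group, f is a
sum of equal powers of two linear forms whose zeros are fixed or interchanged by the group, and its
partial derivatives have no common zero (`hasCompression_of_pair`).

It remains to find invariants in the degrees d + 1 with s_d ≠ 0. In the polyhedral case these
degrees are sums of 2a, 4a − 4 and 6a − 6, and forms vanishing on special orbits have invariant
powers or products of these degrees (`subst_pointsForm_pow`). In the other cases d + 1 is a multiple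
of 2ℓ.

The classification is Klein's. A nontrivial element has exactly two fixed points, and stabilizers
are cyclic (`hasTwoFixedPoints`); counting orbits then leaves few numerical types
(`HasTwoFixedPoints.classification`). The polyhedral groups are recognised by their faithful action
on four Sylow 3-subgroups or five Sylow 2-subgroups. The series is unique because it can be read off
from the order, cyclicity and the existence of an element of large order (`IsSeriesOf.eq_seriesOf`).
-/

namespace CremonaOne
open MvPolynomial

/-! ### Binary forms and their zeros on the projective line. -/

section Forms

variable {k : Type*} [Field k]

lemma eval_smul_of_isHomogeneous {Q : MvPolynomial (Fin 2) k} {n : ℕ} (hQ : Q.IsHomogeneous n)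
    (c : k) (v : Fin 2 → k) : eval (c • v) Q = c ^ n * eval v Q := by
  rw [eval_eq, eval_eq, Finset.mul_sum]
  refine Finset.sum_congr rfl fun m hm => ?_
  have : ∏ i ∈ m.support, c ^ m i = c ^ n := by
    rw [Finset.prod_pow_eq_pow_sum, hQ.degree_eq_sum_deg_support hm]
  simp only [Pi.smul_apply, smul_eq_mul, mul_pow, Finset.prod_mul_distrib, this]
  ring

lemma polyMap_smul {F : Fin 2 → MvPolynomial (Fin 2) k} {n : ℕ} (hF : ∀ i, (F i).IsHomogeneous n)
    (c : k) (v : Fin 2 → k) : polyMap F (c • v) = c ^ n • polyMap F v := by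
  ext i
  simp [polyMap, eval_smul_of_isHomogeneous (hF i)]

/-- The dehomogenization of a binary form. -/
noncomputable def dehom (Q : MvPolynomial (Fin 2) k) : Polynomial k :=
  aeval ![Polynomial.X, 1] Q

lemma eval_dehom (Q : MvPolynomial (Fin 2) k) (t : k) :
    (dehom Q).eval t = eval ![t, 1] Q := by
  have : ((Polynomial.evalRingHom t : Polynomial k →+* k).comp
      (aeval ![(Polynomial.X : Polynomial k), 1] : MvPolynomial (Fin 2) k →ₐ[k] _).toRingHom)
      = eval ![t, 1] := by
    refine MvPolynomial.ringHom_ext (by simp) fun i => ?_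
    fin_cases i <;> simp
  exact DFunLike.congr_fun this Q

lemma homogenize_dehom {Q : MvPolynomial (Fin 2) k} {n : ℕ} (hQ : Q.IsHomogeneous n) :
    (dehom Q).homogenize n = Q :=
  Polynomial.homogenize_eq_of_isHomogeneous hQ rfl

lemma natDegree_dehom_le {Q : MvPolynomial (Fin 2) k} {n : ℕ} (hQ : Q.IsHomogeneous n) :
    (dehom Q).natDegree ≤ n := by
  rw [dehom, Q.as_sum, map_sum]
  refine Polynomial.natDegree_sum_le_of_forall_le _ _ fun m hm => ?_
  have h : m 0 + m 1 = n := by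
    have := hQ.degree_eq_sum_deg_support hm
    rw [← Finsupp.degree_apply, Finsupp.degree_eq_sum, Fin.sum_univ_two] at this
    exact this.symm
  rw [aeval_monomial, Finsupp.prod_fintype _ _ (by simp)]
  simp only [Fin.prod_univ_two, Matrix.cons_val_zero, Matrix.cons_val_one, one_pow, mul_one,
    Polynomial.algebraMap_eq]
  exact (Polynomial.natDegree_C_mul_X_pow_le _ _).trans (by lia)

lemma dehom_ne_zero {Q : MvPolynomial (Fin 2) k} {n : ℕ} (hQ : Q.IsHomogeneous n) (h : Q ≠ 0) :
    dehom Q ≠ 0 := fun h0 => h <| by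
  rw [← homogenize_dehom hQ, h0, Polynomial.homogenize_zero]

lemma eval_homogenize_one_zero (p : Polynomial k) (n : ℕ) :
    eval ![1, 0] (p.homogenize n) = p.coeff n := by
  rw [Polynomial.homogenize, eval_sum, Finset.sum_eq_single (n, 0)]
  · simp [eval_monomial, Finsupp.prod_fintype]
  · rintro ⟨a, b⟩ hab hne
    have hb : b ≠ 0 := by
      rintro rfl
      simp at hab
      exact hne (by simp [hab])
    simp [eval_monomial, Finsupp.prod_fintype, hb]
  · simp

/-- The coefficient in degree n controls the zero at [1 : 0], which the roots of the
dehomogenization do not see. -/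
lemma coeff_dehom {Q : MvPolynomial (Fin 2) k} {n : ℕ} (hQ : Q.IsHomogeneous n) :
    (dehom Q).coeff n = eval ![1, 0] Q := by
  rw [← eval_homogenize_one_zero, homogenize_dehom hQ]

/-- A binary form of positive degree over an algebraically closed field has a nontrivial zero. -/
lemma exists_nontrivial_zero [IsAlgClosed k] {Q : MvPolynomial (Fin 2) k} {n : ℕ}
    (hQ : Q.IsHomogeneous n) (hn : n ≠ 0) : ∃ v : Fin 2 → k, v ≠ 0 ∧ eval v Q = 0 := by
  by_cases h : eval ![1, 0] Q = 0
  · exact ⟨_, fun h0 => by simpa using congrFun h0 0, h⟩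
  · rw [← coeff_dehom hQ] at h
    obtain ⟨t, ht⟩ := IsAlgClosed.exists_root (dehom Q) (fun h0 => hn <| by
      have := Polynomial.le_natDegree_of_ne_zero h
      have := Polynomial.natDegree_eq_of_degree_eq_some (n := 0) h0
      lia)
    exact ⟨![t, 1], fun h0 => by simpa using congrFun h0 1, by rwa [← eval_dehom]⟩

/-- The point `[t : 1]` of the projective line. -/
def affinePoint (t : k) : P1 k :=
  Projectivization.mk k ![t, 1] fun h => by simpa using congrFun h 1

lemma affinePoint_injective : Function.Injective (affinePoint : k → P1 k) := by
  intro s t h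
  rw [affinePoint, affinePoint, Projectivization.mk_eq_mk_iff'] at h
  obtain ⟨a, ha⟩ := h
  have h0 := congrFun ha 0
  have h1 := congrFun ha 1
  simp at h0 h1
  rw [← h0, h1, one_mul]

lemma eq_affinePoint_or (p : P1 k) :
    (∃ t, p = affinePoint t) ∨
      p = Projectivization.mk k ![1, 0] (fun h => by simpa using congrFun h 0) := by
  induction p using Projectivization.ind with | _ v hv
  by_cases h : v 1 = 0
  · right
    rw [Projectivization.mk_eq_mk_iff']
    exact ⟨v 0, by ext i; fin_cases i <;> simp [h]⟩
  · left
    refine ⟨v 0 / v 1, ?_⟩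
    rw [affinePoint, Projectivization.mk_eq_mk_iff']
    exact ⟨v 1, by ext i; fin_cases i <;> simp [mul_div_cancel₀, h]⟩

/-- A nonzero binary form has finitely many zeros on the projective line. -/
lemma finite_zeros {Q : MvPolynomial (Fin 2) k} {n : ℕ}
    (hQ : Q.IsHomogeneous n) (h : Q ≠ 0) :
    {p : P1 k | eval p.rep Q = 0}.Finite := by
  have h1 : {t : k | (dehom Q).eval t = 0}.Finite :=
    ((dehom Q).rootSet_finite k).subset fun t ht => by
      simpa [Polynomial.mem_rootSet, dehom_ne_zero hQ h] using ht
  refine ((h1.image affinePoint).union (Set.finite_singleton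
    (Projectivization.mk k ![1, 0] (fun h => by simpa using congrFun h 0)))).subset ?_
  intro p hp
  rcases eq_affinePoint_or p with ⟨t, rfl⟩ | rfl
  · refine Or.inl ⟨t, ?_, rfl⟩
    obtain ⟨a, ha⟩ := Projectivization.exists_smul_eq_mk_rep k (![t, 1] : Fin 2 → k)
      (fun h => by simpa using congrFun h 1)
    rw [Set.mem_ofPred, affinePoint, ← ha, Units.smul_def, eval_smul_of_isHomogeneous hQ] at hp
    simpa [eval_dehom] using hp
  · exact Or.inr rfl

end Forms
end CremonaOne

namespace CremonaOne
open MvPolynomial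

/-! ### Self-maps of the projective line given by pairs of forms without common zeros. -/

section Descent

variable {k : Type*} [Field k]

/-- The self-map of the projective line given by two forms without common zeros. -/
noncomputable def descent (F : Fin 2 → MvPolynomial (Fin 2) k)
    (h : ∀ v ≠ 0, polyMap F v ≠ 0) (p : P1 k) : P1 k :=
  Projectivization.mk k (polyMap F p.rep) (h _ p.rep_nonzero)

variable {F : Fin 2 → MvPolynomial (Fin 2) k} {e : ℕ}

lemma descent_mk (h : ∀ v ≠ 0, polyMap F v ≠ 0) (hF : ∀ i, (F i).IsHomogeneous e)
    {v : Fin 2 → k} (hv : v ≠ 0) :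
    descent F h (Projectivization.mk k v hv) = Projectivization.mk k (polyMap F v) (h v hv) := by
  obtain ⟨a, ha⟩ := Projectivization.exists_smul_eq_mk_rep k v hv
  rw [descent, Projectivization.mk_eq_mk_iff']
  exact ⟨(a : k) ^ e, by rw [← ha, Units.smul_def, polyMap_smul hF]⟩

/-- Equality of points becomes the vanishing of a polynomial, so that identities between maps of the
line can be proved as identities between forms. -/
lemma mk_eq_mk_iff_wedge {v w : Fin 2 → k} (hv : v ≠ 0) (hw : w ≠ 0) :
    Projectivization.mk k v hv = Projectivization.mk k w hw ↔ v 0 * w 1 - v 1 * w 0 = 0 := by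
  rw [Projectivization.mk_eq_mk_iff']
  constructor
  · rintro ⟨a, rfl⟩
    simp
    ring
  · intro h
    by_cases h0 : w 0 = 0
    · have h1 : w 1 ≠ 0 := fun h1 => hw (by ext i; fin_cases i <;> simp [h0, h1])
      have : v 0 = 0 := by simpa [h0, h1] using h
      exact ⟨v 1 / w 1, by ext i; fin_cases i <;> simp [h0, this, h1]⟩
    · refine ⟨v 0 / w 0, ?_⟩
      ext i
      fin_cases i
      · simp [h0]
      · simp only [Fin.mk_one, Pi.smul_apply, smul_eq_mul]
        field_simp
        linear_combination h

/-- The preimages of [w] are the zeros of the form w₁F₀ − w₀F₁, whose degree is positive. -/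
lemma descent_surjective [IsAlgClosed k] (h : ∀ v ≠ 0, polyMap F v ≠ 0)
    (hF : ∀ i, (F i).IsHomogeneous e) (he : e ≠ 0) : Function.Surjective (descent F h) := by
  intro p
  induction p using Projectivization.ind with | _ w hw
  obtain ⟨v, hv, hz⟩ := exists_nontrivial_zero
    (((hF 0).C_mul (w 1)).sub ((hF 1).C_mul (w 0))) he
  refine ⟨Projectivization.mk k v hv, ?_⟩
  rw [descent_mk h hF, mk_eq_mk_iff_wedge]
  simp only [eval_sub, eval_mul, eval_C] at hz
  simp only [polyMap]
  linear_combination hz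

lemma isZariskiOpen_univ : IsZariskiOpen (Set.univ : Set (P1 k)) :=
  ⟨{1}, fun F hF => ⟨0, by rw [hF]; exact isHomogeneous_one _ _⟩, fun v hv => by simp⟩

lemma isRegularOn_descent (h : ∀ v ≠ 0, polyMap F v ≠ 0) (hF : ∀ i, (F i).IsHomogeneous e) :
    IsRegularOn (descent F h) Set.univ := fun _ _ =>
  ⟨Set.univ, isZariskiOpen_univ, trivial, subset_rfl, e, F, hF,
    fun v hv _ => ⟨h v hv, descent_mk h hF hv⟩⟩

/-- A nonempty Zariski open subset of the projective line is cofinite. -/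
lemma IsZariskiOpen.finite_compl {U : Set (P1 k)} (hU : IsZariskiOpen U) (hne : U.Nonempty) :
    Uᶜ.Finite := by
  obtain ⟨S, hS, hU⟩ := hU
  obtain ⟨p, hp⟩ := hne
  rw [← p.mk_rep, hU] at hp
  obtain ⟨Q, hQ, hQp⟩ := hp
  obtain ⟨n, hn⟩ := hS Q hQ
  refine (finite_zeros hn (by rintro rfl; simp at hQp)).subset fun q hq => ?_
  by_contra h
  exact hq (by rw [← q.mk_rep, hU]; exact ⟨Q, hQ, h⟩)

lemma isCoprime_dehom [IsAlgClosed k] (h : ∀ v ≠ 0, polyMap F v ≠ 0) :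
    IsCoprime (dehom (F 0)) (dehom (F 1)) := by
  refine (Polynomial.isCoprime_iff_aeval_ne_zero_of_isAlgClosed (k := k) k _ _).2 ?_
  intro t
  by_contra! ht
  refine h ![t, 1] (fun h0 => by simpa using congrFun h0 1) ?_
  ext i
  fin_cases i
  · simpa [polyMap, ← eval_dehom] using ht.1
  · simpa [polyMap, ← eval_dehom] using ht.2

/-- Coprime polynomials with zero Wronskian have zero derivatives, hence are constant in
characteristic zero; two forms of positive degree with constant dehomogenizations both vanish at [1
: 0]. -/
lemma wronskian_dehom_ne_zero [IsAlgClosed k] [CharZero k] (h : ∀ v ≠ 0, polyMap F v ≠ 0)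
    (hF : ∀ i, (F i).IsHomogeneous e) (he : e ≠ 0) :
    (dehom (F 0)).wronskian (dehom (F 1)) ≠ 0 := by
  rw [Ne, (isCoprime_dehom h).wronskian_eq_zero_iff]
  rintro ⟨h0, h1⟩
  refine h ![1, 0] (fun h0 => by simpa using congrFun h0 0) ?_
  have key : ∀ i, Polynomial.derivative (dehom (F i)) = 0 → polyMap F ![1, 0] i = 0 := by
    intro i hi
    rw [polyMap, ← coeff_dehom (hF i)]
    apply Polynomial.coeff_eq_zero_of_natDegree_lt
    rw [Polynomial.derivative_eq_zero.1 hi]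
    lia
  ext i
  fin_cases i
  · exact key 0 h0
  · exact key 1 h1

/-- In characteristic zero, a self-map of degree at least two of the projective line is not
injective on any cofinite set. -/
lemma not_injOn_descent [IsAlgClosed k] [CharZero k] (h : ∀ v ≠ 0, polyMap F v ≠ 0)
    (hF : ∀ i, (F i).IsHomogeneous e) (he : 2 ≤ e) {U : Set (P1 k)} (hU : Uᶜ.Finite) :
    ¬ Set.InjOn (descent F h) U := by
  intro hinj
  set p := dehom (F 0) with hp
  set q := dehom (F 1) with hq
  have hW := wronskian_dehom_ne_zero h hF (by lia)
  -- The parameters to avoid: those of points outside `U` and the ramification points.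
  have hB : (affinePoint ⁻¹' Uᶜ ∪ {t : k | (p.wronskian q).eval t = 0}).Finite := by
    refine (hU.preimage affinePoint_injective.injOn).union ?_
    refine ((p.wronskian q).rootSet_finite k).subset fun t ht => ?_
    exact Polynomial.mem_rootSet.2 ⟨hW, by simpa using ht⟩
  -- A general value c: neither the image of a parameter to avoid nor the value at [1 : 0]. Where a
  -- denominator is zero the quotient is 0, which at worst excludes one more value.
  obtain ⟨c, hc⟩ := (((hB.image fun t => p.eval t / q.eval t).union
    (Set.finite_singleton (p.coeff e / q.coeff e)))).exists_notMem
  simp only [Set.mem_union, Set.mem_image, Set.mem_singleton_iff, not_or, not_exists,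
    not_and] at hc
  have hroot : ∀ t, (p - Polynomial.C c * q).eval t = 0 →
      q.eval t ≠ 0 ∧ affinePoint t ∈ U ∧ (p.wronskian q).eval t ≠ 0 := by
    intro t ht
    simp only [Polynomial.eval_sub, Polynomial.eval_mul, Polynomial.eval_C] at ht
    have hqt : q.eval t ≠ 0 := by
      intro h0
      refine h ![t, 1] (fun h0 => by simpa using congrFun h0 1) ?_
      ext i
      fin_cases i
      · simpa [polyMap, ← eval_dehom, ← hp, h0] using ht
      · simpa [polyMap, ← eval_dehom] using h0
    have hct : p.eval t / q.eval t = c := by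
      field_simp
      linear_combination ht
    have := hc.1 t
    refine ⟨hqt, ?_, ?_⟩
    · by_contra h1
      exact this (Or.inl h1) hct
    · intro h1
      exact this (Or.inr h1) hct
  -- Since c is not the value at [1 : 0], the polynomial p − cq has full degree e ≥ 2. It therefore
  -- has a second root t', counted with multiplicity.
  have hcoeff : (p - Polynomial.C c * q).coeff e ≠ 0 := by
    rw [Polynomial.coeff_sub, Polynomial.coeff_C_mul]
    intro h0
    by_cases hqe : q.coeff e = 0
    · refine h ![1, 0] (fun h0 => by simpa using congrFun h0 0) ?_
      ext i
      fin_cases i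
      · simpa [polyMap, ← coeff_dehom (hF 0), ← hp, hqe] using h0
      · simpa [polyMap, ← coeff_dehom (hF 1)] using hqe
    · apply hc.2
      field_simp
      linear_combination - h0
  have hdeg := Polynomial.le_natDegree_of_ne_zero hcoeff
  obtain ⟨t, ht⟩ := IsAlgClosed.exists_root (p - Polynomial.C c * q) (fun h0 => by
    have := Polynomial.natDegree_eq_of_degree_eq_some (n := 0) h0
    lia)
  obtain ⟨s, hs⟩ := Polynomial.dvd_iff_isRoot.mpr ht
  have hs0 : s ≠ 0 := by
    rintro rfl
    simp [hs] at hcoeff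
  have hsdeg : 1 ≤ s.natDegree := by
    rw [hs, Polynomial.natDegree_mul (Polynomial.X_sub_C_ne_zero t) hs0,
      Polynomial.natDegree_X_sub_C] at hdeg
    lia
  obtain ⟨t', ht'⟩ := IsAlgClosed.exists_root s (fun h0 => by
    have := Polynomial.natDegree_eq_of_degree_eq_some (n := 0) h0
    lia)
  have ht'' : (p - Polynomial.C c * q).eval t' = 0 := by
    rw [hs, Polynomial.eval_mul, ht', mul_zero]
  obtain ⟨hq1, hU1, hW1⟩ := hroot t ht
  obtain ⟨hq2, hU2, hW2⟩ := hroot t' ht''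
  -- Both roots lie in the fibre over c, so injectivity makes them equal; a double root of p − cq is
  -- a zero of the Wronskian.
  have htt : t = t' := by
    refine affinePoint_injective (hinj hU1 hU2 ?_)
    rw [affinePoint, affinePoint, descent_mk h hF, descent_mk h hF, mk_eq_mk_iff_wedge]
    simp only [polyMap, ← eval_dehom]
    have e1 : p.eval t - c * q.eval t = 0 := by simpa using ht
    have e2 : p.eval t' - c * q.eval t' = 0 := by simpa using ht''
    linear_combination q.eval t' * e1 - q.eval t * e2
  subst htt
  apply hW1
  have e1 : p.eval t - c * q.eval t = 0 := by simpa using ht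
  have e2 : (Polynomial.derivative (p - Polynomial.C c * q)).eval t = 0 := by
    rw [hs, Polynomial.derivative_mul]
    simp [ht'.eq_zero]
  have e3 : (Polynomial.derivative p).eval t - c * (Polynomial.derivative q).eval t = 0 := by
    simpa using e2
  rw [Polynomial.wronskian, Polynomial.eval_sub, Polynomial.eval_mul, Polynomial.eval_mul]
  linear_combination (Polynomial.derivative q).eval t * e1 - q.eval t * e3

lemma not_isBirationalIso_descent [IsAlgClosed k] [CharZero k] (h : ∀ v ≠ 0, polyMap F v ≠ 0)
    (hF : ∀ i, (F i).IsHomogeneous e) (he : 2 ≤ e) : ¬ IsBirationalIso (descent F h) := by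
  rintro ⟨U, V, hU, hUne, -, -, g, -, -, -, -, hg⟩
  exact not_injOn_descent h hF he (hU.finite_compl hUne) hg.1.injOn

end Descent
end CremonaOne

namespace CremonaOne
open MvPolynomial

/-! ### From an equivariant pair of forms to a nontrivial self-compression. -/

section Compression

variable {k : Type*} [Field k]

/-- The linear substitution of variables by a matrix. -/
noncomputable def subst (g : SL2 k) : MvPolynomial (Fin 2) k →ₐ[k] MvPolynomial (Fin 2) k :=
  aeval fun i => ∑ j, C (g.1 i j) * X j

lemma SL2_smul_apply (g : SL2 k) (v : Fin 2 → k) (i : Fin 2) :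
    (g • v) i = g.1 i 0 * v 0 + g.1 i 1 * v 1 := by
  simp [Matrix.SpecialLinearGroup.smul_def, Matrix.mulVec, dotProduct, Fin.sum_univ_two]

lemma SL2_det (g : SL2 k) : g.1 0 0 * g.1 1 1 - g.1 0 1 * g.1 1 0 = 1 := by
  rw [← Matrix.det_fin_two, g.2]

lemma eval_subst (g : SL2 k) (Q : MvPolynomial (Fin 2) k) (v : Fin 2 → k) :
    eval v (subst g Q) = eval (g • v) Q := by
  have : ((eval v).comp (subst g : MvPolynomial (Fin 2) k →ₐ[k] _).toRingHom) = eval (g • v) := by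
    refine MvPolynomial.ringHom_ext (by simp) fun i => ?_
    simp [subst, SL2_smul_apply, Fin.sum_univ_two]
  exact DFunLike.congr_fun this Q

lemma wedge_smul (g : SL2 k) (v w : Fin 2 → k) :
    (g • v) 0 * (g • w) 1 - (g • v) 1 * (g • w) 0 = v 0 * w 1 - v 1 * w 0 := by
  simp only [SL2_smul_apply]
  linear_combination (v 0 * w 1 - v 1 * w 0) * SL2_det g

variable {F F₀ : Fin 2 → MvPolynomial (Fin 2) k} {P : MvPolynomial (Fin 2) k} {d e : ℕ}

lemma polyMap_eq_smul (hPF : ∀ i, F i = P * F₀ i) (v : Fin 2 → k) :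
    polyMap F v = eval v P • polyMap F₀ v := by
  ext i
  simp [polyMap, hPF]

/-- Equivariance of a pair of forms passes to the map of the projective line obtained by removing
a common factor. -/
lemma descent_smul [Infinite k] (h : ∀ v ≠ 0, polyMap F₀ v ≠ 0)
    (hF₀ : ∀ i, (F₀ i).IsHomogeneous e) (hP : P ≠ 0) (hPF : ∀ i, F i = P * F₀ i) {g : SL2 k}
    (hg : ∀ v, polyMap F (g • v) = g • polyMap F v) (p : P1 k) :
    descent F₀ h (g • p) = g • descent F₀ h p := by
  induction p using Projectivization.ind with | _ v hv
  rw [Projectivization.smul_mk, descent_mk h hF₀, descent_mk h hF₀, Projectivization.smul_mk,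
    mk_eq_mk_iff_wedge]
  set W : MvPolynomial (Fin 2) k :=
    subst g (F₀ 0) * (C (g.1 1 0) * F₀ 0 + C (g.1 1 1) * F₀ 1)
      - subst g (F₀ 1) * (C (g.1 0 0) * F₀ 0 + C (g.1 0 1) * F₀ 1) with hW
  have hWe : ∀ v, eval v W = polyMap F₀ (g • v) 0 * (g • polyMap F₀ v) 1
      - polyMap F₀ (g • v) 1 * (g • polyMap F₀ v) 0 := by
    intro v
    simp [hW, eval_subst, SL2_smul_apply, polyMap]
  -- Equivariance of F says nothing about F₀ where P vanishes. The identity is therefore proved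
  -- after multiplication by P(gv)P(v), and these factors are cancelled as polynomials.
  have hzero : subst g P * (P * W) = 0 := by
    refine MvPolynomial.funext fun v => ?_
    rw [eval_mul, eval_mul, eval_subst, hWe, map_zero]
    have hgv := hg v
    rw [polyMap_eq_smul hPF, polyMap_eq_smul hPF, smul_comm g] at hgv
    have h0 := congrFun hgv 0
    have h1 := congrFun hgv 1
    simp only [Pi.smul_apply, smul_eq_mul] at h0 h1
    linear_combination (eval v P * (g • polyMap F₀ v) 1) * h0
      - (eval v P * (g • polyMap F₀ v) 0) * h1
  have hsP : subst g P ≠ 0 := by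
    intro h0
    apply hP
    refine MvPolynomial.funext fun v => ?_
    have := eval_subst g P (g⁻¹ • v)
    rw [h0, smul_inv_smul] at this
    rw [← this, map_zero, map_zero]
  have : W = 0 := by
    simpa [hsP, hP] using hzero
  rw [← hWe, this, map_zero]

/-- A pair of forms that defines a nonconstant map of the projective line has Zariski dense image
in the plane. -/
lemma dense_range_polyMap [IsAlgClosed k] (hF : ∀ i, (F i).IsHomogeneous d)
    (h : ∀ v ≠ 0, polyMap F₀ v ≠ 0)
    (hF₀ : ∀ i, (F₀ i).IsHomogeneous e) (he : e ≠ 0) (hd : d ≠ 0) {n : ℕ}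
    (hPn : P.IsHomogeneous n) (hP : P ≠ 0) (hPF : ∀ i, F i = P * F₀ i) :
    zeroLocus k (vanishingIdeal k (Set.range (polyMap F))) = Set.univ := by
  have hinf : Infinite k := IsAlgClosed.instInfinite
  have hfin := (finite_zeros hPn hP).image (descent F₀ h)
  have hA := (hfin.preimage affinePoint_injective.injOn).infinite_compl
  -- All but finitely many lines through the origin lie in the image: such a line is the image of a
  -- direction on which P does not vanish, and scaling by d-th roots reaches each of its points.
  have hmem : ∀ a ∈ (affinePoint ⁻¹' (descent F₀ h '' {p | eval p.rep P = 0}))ᶜ, ∀ y : k,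
      ![a * y, y] ∈ Set.range (polyMap F) := by
    intro a ha y
    obtain ⟨p, hp⟩ := descent_surjective h hF₀ he (affinePoint a)
    have hPp : eval p.rep P ≠ 0 := fun h0 => ha ⟨p, h0, hp⟩
    rw [descent, affinePoint, Projectivization.mk_eq_mk_iff'] at hp
    obtain ⟨c, hc⟩ := hp
    have hc0 : c ≠ 0 := by
      rintro rfl
      exact h _ p.rep_nonzero (by rw [← hc, zero_smul])
    obtain ⟨s, hs⟩ := IsAlgClosed.exists_pow_nat_eq (y / (eval p.rep P * c))
      (Nat.pos_of_ne_zero hd)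
    refine ⟨s • p.rep, ?_⟩
    rw [polyMap_smul hF, polyMap_eq_smul hPF, ← hc, hs, smul_smul, smul_smul]
    have : y / (eval p.rep P * c) * (eval p.rep P * c) = y := by
      field_simp
    rw [mul_assoc, this]
    ext i
    fin_cases i <;> simp [mul_comm]
  have hvan : ∀ Q ∈ vanishingIdeal k (Set.range (polyMap F)), Q = 0 := by
    intro Q hQ
    -- The substitution (x, y) ↦ (xy, y) straightens the pencil of lines, so the pullback of Q
    -- vanishes on a product of infinite sets.
    have h1 : aeval ![X 0 * X 1, X 1] Q = (0 : MvPolynomial (Fin 2) k) := by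
      refine MvPolynomial.funext_set
        ![(affinePoint ⁻¹' (descent F₀ h '' {p | eval p.rep P = 0}))ᶜ, Set.univ]
        (fun i => ?_) fun x hx => ?_
      · fin_cases i
        · exact hA
        · exact Set.infinite_univ
      · have hx0 := hmem _ (hx 0 trivial) (x 1)
        have := (mem_vanishingIdeal_iff.1 hQ) _ hx0
        rw [map_zero, ← this]
        have hcomp : ((eval x).comp (aeval ![X 0 * X 1, X 1] :
            MvPolynomial (Fin 2) k →ₐ[k] MvPolynomial (Fin 2) k).toRingHom)
            = (aeval ![x 0 * x 1, x 1] : MvPolynomial (Fin 2) k →ₐ[k] k).toRingHom := by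
          refine MvPolynomial.ringHom_ext (by simp) fun i => ?_
          fin_cases i <;> simp
        exact DFunLike.congr_fun hcomp Q
    -- The substitution can be inverted only where `X 1` is nonzero, hence the extra factor.
    have h2 : X 1 * Q = 0 := by
      refine MvPolynomial.funext fun v => ?_
      by_cases hv : v 1 = 0
      · simp [hv]
      · have := congrArg (eval ![v 0 / v 1, v 1]) h1
        have hcomp : ((eval ![v 0 / v 1, v 1]).comp (aeval ![X 0 * X 1, X 1] :
            MvPolynomial (Fin 2) k →ₐ[k] MvPolynomial (Fin 2) k).toRingHom) = eval v := by
          refine MvPolynomial.ringHom_ext (by simp) fun i => ?_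
          fin_cases i <;> simp [hv]
        have h3 := DFunLike.congr_fun hcomp Q
        rw [map_zero] at this
        rw [eval_mul, ← h3]
        simpa using Or.inr this
    simpa using h2
  rw [Set.eq_univ_iff_forall]
  intro x Q hQ
  rw [hvan Q hQ, map_zero]

/-- An equivariant pair of forms that defines a map of degree at least two of the projective line
is a homogeneous self-compression that descends to a nontrivial self-compression. -/
theorem compression_of_factorization [IsAlgClosed k] [CharZero k] (G : Subgroup (PSL2 k))
    (hF : ∀ i, (F i).IsHomogeneous d)
    (hequiv : ∀ g ∈ binaryGroup G, ∀ v, polyMap F (g • v) = g • polyMap F v)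
    (h : ∀ v ≠ 0, polyMap F₀ v ≠ 0)
    (hF₀ : ∀ i, (F₀ i).IsHomogeneous e) (he : 2 ≤ e) (hd : d ≠ 0) {n : ℕ}
    (hPn : P.IsHomogeneous n) (hP : P ≠ 0) (hPF : ∀ i, F i = P * F₀ i) :
    IsHomogeneousSelfCompression (binaryGroup G) d F ∧
      ∃ f : P1 k → P1 k, IsDescent F f ∧ IsNontrivialSelfCompression G f := by
  have hinf : Infinite k := IsAlgClosed.instInfinite
  refine ⟨⟨hF, hequiv, dense_range_polyMap hF h hF₀ (by lia) hd hPn hP hPF⟩,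
    descent F₀ h, ?_, ⟨⟨isRegularOn_descent h hF₀, ?_, ?_⟩, not_isBirationalIso_descent h hF₀ he⟩⟩
  · intro v hv hFv
    rw [descent_mk h hF₀, mk_eq_mk_iff_wedge, polyMap_eq_smul hPF]
    simp
    ring
  · rintro U - ⟨q, hq⟩
    obtain ⟨p, rfl⟩ := descent_surjective h hF₀ (by lia) q
    exact ⟨p, hq⟩
  · intro g hg p
    obtain ⟨g, rfl⟩ := QuotientGroup.mk_surjective g
    rw [Matrix.ProjectiveSpecialLinearGroup.smul_proj_mk,
      Matrix.ProjectiveSpecialLinearGroup.smul_proj_mk]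
    exact descent_smul h hF₀ hP hPF (hequiv g hg) p

end Compression
end CremonaOne

namespace CremonaOne
open MvPolynomial

/-! ### Number of zeros, and common factors of two binary forms. -/

section Factorization

variable {k : Type*} [Field k]

/-- The number of zeros on the projective line of a nonzero binary form is at most its degree. -/
lemma ncard_zeros_le {Q : MvPolynomial (Fin 2) k} {n : ℕ}
    (hQ : Q.IsHomogeneous n) (h : Q ≠ 0) :
    {p : P1 k | eval p.rep Q = 0}.ncard ≤ n := by
  classical
  have hd := dehom_ne_zero hQ h
  have hrep : ∀ (v : Fin 2 → k) (hv : v ≠ 0),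
      eval (Projectivization.mk k v hv).rep Q = 0 → eval v Q = 0 := by
    intro v hv h0
    obtain ⟨a, ha⟩ := Projectivization.exists_smul_eq_mk_rep k v hv
    rw [← ha, Units.smul_def, eval_smul_of_isHomogeneous hQ] at h0
    simpa using h0
  have hcard : (dehom Q).roots.toFinset.card ≤ (dehom Q).natDegree :=
    (Multiset.toFinset_card_le _).trans (Polynomial.card_roots' _)
  have hdeg := natDegree_dehom_le hQ
  have hroots : ∀ t, affinePoint t ∈ {p : P1 k | eval p.rep Q = 0} →
      t ∈ (dehom Q).roots.toFinset := by
    intro t ht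
    have := hrep _ _ ht
    rw [← eval_dehom] at this
    simpa [hd] using this
  set p₀ := Projectivization.mk k (![1, 0] : Fin 2 → k) (fun h => by simpa using congrFun h 0)
  by_cases h0 : p₀ ∈ {p : P1 k | eval p.rep Q = 0}
  · have hlt : (dehom Q).natDegree ≠ n := by
      intro hn
      have h1 := hrep _ _ h0
      rw [← coeff_dehom hQ, ← hn, Polynomial.coeff_natDegree, Polynomial.leadingCoeff_eq_zero]
        at h1
      exact hd h1
    have hsub : {p : P1 k | eval p.rep Q = 0} ⊆
        (insert p₀ ((dehom Q).roots.toFinset.image affinePoint) : Finset (P1 k)) := by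
      intro p hp
      rcases eq_affinePoint_or p with ⟨t, rfl⟩ | rfl
      · simp only [Finset.coe_insert, Finset.coe_image]
        exact Or.inr ⟨t, hroots t hp, rfl⟩
      · simp [p₀]
    calc _ ≤ ((insert p₀ ((dehom Q).roots.toFinset.image affinePoint) : Finset (P1 k)) :
          Set (P1 k)).ncard := Set.ncard_le_ncard hsub (Finset.finite_toSet _)
      _ ≤ n := by
        rw [Set.ncard_coe_finset]
        refine (Finset.card_insert_le _ _).trans ?_
        have := (Finset.card_image_le (s := (dehom Q).roots.toFinset) (f := affinePoint))
        lia
  · have hsub : {p : P1 k | eval p.rep Q = 0} ⊆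
        ((dehom Q).roots.toFinset.image affinePoint : Finset (P1 k)) := by
      intro p hp
      rcases eq_affinePoint_or p with ⟨t, rfl⟩ | rfl
      · simp only [Finset.coe_image]
        exact ⟨t, hroots t hp, rfl⟩
      · exact absurd hp h0
    refine (Set.ncard_le_ncard hsub (Finset.finite_toSet _)).trans ?_
    rw [Set.ncard_coe_finset]
    exact Finset.card_image_le.trans (hcard.trans hdeg)

lemma exists_coprime_factorization {p q : Polynomial k} (h : p ≠ 0 ∨ q ≠ 0) :
    ∃ g p₀ q₀ : Polynomial k, g ≠ 0 ∧ p = g * p₀ ∧ q = g * q₀ ∧ IsCoprime p₀ q₀ := by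
  classical
  obtain ⟨p₀, hp⟩ := EuclideanDomain.gcd_dvd_left p q
  obtain ⟨q₀, hq⟩ := EuclideanDomain.gcd_dvd_right p q
  have hg : EuclideanDomain.gcd p q ≠ 0 := by
    intro h0
    rw [EuclideanDomain.gcd_eq_zero_iff] at h0
    tauto
  refine ⟨_, p₀, q₀, hg, hp, hq, EuclideanDomain.gcdA p q, EuclideanDomain.gcdB p q, ?_⟩
  have hab := EuclideanDomain.gcd_eq_gcd_ab p q
  apply mul_left_cancel₀ hg
  set a := EuclideanDomain.gcdA p q
  set b := EuclideanDomain.gcdB p q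
  set g := EuclideanDomain.gcd p q
  rw [mul_one]
  conv_rhs => rw [hab]
  linear_combination - a * hp - b * hq

/-- A pair of binary forms of the same degree, not both zero, is the product of its greatest
common divisor and a pair of forms without common zeros. -/
lemma exists_factorization {F : Fin 2 → MvPolynomial (Fin 2) k} {d : ℕ}
    (hF : ∀ i, (F i).IsHomogeneous d) (hne : F ≠ 0) :
    ∃ (n e : ℕ) (P : MvPolynomial (Fin 2) k) (F₀ : Fin 2 → MvPolynomial (Fin 2) k),
      P.IsHomogeneous n ∧ P ≠ 0 ∧ (∀ i, (F₀ i).IsHomogeneous e) ∧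
      (∀ v ≠ 0, polyMap F₀ v ≠ 0) ∧ ∀ i, F i = P * F₀ i := by
  have hne' : dehom (F 0) ≠ 0 ∨ dehom (F 1) ≠ 0 := by
    by_contra! h0
    apply hne
    ext1 i
    rw [Pi.zero_apply, ← homogenize_dehom (hF i)]
    fin_cases i
    · simp [h0.1]
    · simp [h0.2]
  obtain ⟨g, p, q, hg, hp, hq, hpq⟩ := exists_coprime_factorization hne'
  -- With e the larger of the two degrees, the homogenizations in degree e do not both vanish at [1
  -- : 0], and coprimality excludes the other common zeros. The surplus d − e goes into the common
  -- factor.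
  set e := max p.natDegree q.natDegree with he
  have hcoeff : p.coeff e ≠ 0 ∨ q.coeff e ≠ 0 := by
    rcases max_choice p.natDegree q.natDegree with hm | hm
    · by_cases h0 : p = 0
      · right
        have hq0 : q ≠ 0 := hpq.ne_zero_or_ne_zero.resolve_left (not_not.2 h0)
        have : e = q.natDegree := by
          rw [he, h0, Polynomial.natDegree_zero, Nat.zero_max]
        rw [this]
        simpa using hq0
      · left
        rw [he, hm]
        simpa using h0
    · by_cases h0 : q = 0
      · left
        have hp0 : p ≠ 0 := hpq.ne_zero_or_ne_zero.resolve_right (not_not.2 h0)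
        have : e = p.natDegree := by
          rw [he, h0, Polynomial.natDegree_zero, Nat.max_zero]
        rw [this]
        simpa using hp0
      · right
        rw [he, hm]
        simpa using h0
  have hge : g.natDegree + e ≤ d := by
    have hdp := natDegree_dehom_le (hF 0)
    have hdq := natDegree_dehom_le (hF 1)
    rw [hp] at hdp
    rw [hq] at hdq
    rcases hcoeff with hc | hc
    · have h1 := Polynomial.le_natDegree_of_ne_zero hc
      rw [Polynomial.natDegree_mul hg (by rintro rfl; simp at hc)] at hdp
      lia
    · have h1 := Polynomial.le_natDegree_of_ne_zero hc
      rw [Polynomial.natDegree_mul hg (by rintro rfl; simp at hc)] at hdq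
      lia
  have hd : d = (d - e) + e := by lia
  refine ⟨d - e, e, g.homogenize (d - e), ![p.homogenize e, q.homogenize e],
    Polynomial.isHomogeneous_homogenize _, ?_, ?_, ?_, ?_⟩
  · rwa [Ne, Polynomial.homogenize_eq_zero_iff (by lia)]
  · intro i
    fin_cases i <;> exact Polynomial.isHomogeneous_homogenize _
  · intro v hv h0
    have h0p : eval v (p.homogenize e) = 0 := congrFun h0 0
    have h0q : eval v (q.homogenize e) = 0 := congrFun h0 1
    by_cases hv1 : v 1 = 0
    · have hv0 : v 0 ≠ 0 := fun hv0 => hv (by ext i; fin_cases i <;> simp [hv0, hv1])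
      have hvv : v = v 0 • ![1, 0] := by ext i; fin_cases i <;> simp [hv1]
      rw [hvv, eval_smul_of_isHomogeneous (Polynomial.isHomogeneous_homogenize _),
        eval_homogenize_one_zero] at h0p h0q
      rcases hcoeff with hc | hc
      · simp [hc, hv0] at h0p
      · simp [hc, hv0] at h0q
    · rw [Polynomial.eval_homogenize (le_max_left _ _) _ hv1] at h0p
      rw [Polynomial.eval_homogenize (le_max_right _ _) _ hv1] at h0q
      obtain ⟨a, b, hab⟩ := hpq
      have := congrArg (Polynomial.eval (v 0 / v 1)) hab
      have h1 : p.eval (v 0 / v 1) = 0 := by simpa [hv1] using h0p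
      have h2 : q.eval (v 0 / v 1) = 0 := by simpa [hv1] using h0q
      simp [h1, h2] at this
  · intro i
    fin_cases i
    · change F 0 = _ * p.homogenize e
      rw [← homogenize_dehom (hF 0), hp, ← Polynomial.homogenize_mul _ _ (by lia) (by lia), ← hd]
    · change F 1 = _ * q.homogenize e
      rw [← homogenize_dehom (hF 1), hq, ← Polynomial.homogenize_mul _ _ (by lia) (by lia), ← hd]

end Factorization

/-! ### Equivariant vector fields from invariant forms. -/

section Gradient

variable {k : Type*} [Field k]

/-- The Hamiltonian vector field of a polynomial in two variables. -/
noncomputable def hamiltonian (f : MvPolynomial (Fin 2) k) : Fin 2 → MvPolynomial (Fin 2) k :=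
  ![pderiv 1 f, -pderiv 0 f]

lemma hamiltonian_isHomogeneous {f : MvPolynomial (Fin 2) k} {d : ℕ}
    (hf : f.IsHomogeneous (d + 1)) (i : Fin 2) : (hamiltonian f i).IsHomogeneous d := by
  fin_cases i
  · exact hf.pderiv
  · exact hf.pderiv.neg

lemma pderiv_subst (g : SL2 k) (f : MvPolynomial (Fin 2) k) (j : Fin 2) :
    pderiv j (subst g f) =
      C (g.1 0 j) * subst g (pderiv 0 f) + C (g.1 1 j) * subst g (pderiv 1 f) := by
  induction f using MvPolynomial.induction_on with
  | C a => simp [subst]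
  | add p q hp hq =>
    simp only [map_add, hp, hq]
    ring
  | mul_X p i hp =>
    have hX : pderiv j (subst g (X i)) = C (g.1 i j) := by
      simp only [subst, aeval_X, map_sum, pderiv_C_mul, pderiv_X]
      simp [Pi.single_apply]
    simp only [map_mul, pderiv_mul, hp, hX, map_add, pderiv_X]
    fin_cases i <;> simp <;> ring

/-- The Hamiltonian vector field of an invariant is equivariant. -/
lemma polyMap_hamiltonian_smul {f : MvPolynomial (Fin 2) k} {g : SL2 k} (hf : subst g f = f)
    (v : Fin 2 → k) :
    polyMap (hamiltonian f) (g • v) = g • polyMap (hamiltonian f) v := by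
  -- The gradient of an invariant transforms by the transpose of g. Since det g = 1, the gradient
  -- rotated by a right angle transforms by g itself.
  have h : ∀ j, eval v (pderiv j f) =
      g.1 0 j * eval (g • v) (pderiv 0 f) + g.1 1 j * eval (g • v) (pderiv 1 f) := by
    intro j
    conv_lhs => rw [← hf, pderiv_subst]
    simp [eval_subst]
  have hdet := SL2_det g
  ext i
  rw [SL2_smul_apply]
  fin_cases i
  · simp only [polyMap, hamiltonian, Fin.zero_eta, Matrix.cons_val_zero, Matrix.cons_val_one,
      map_neg, h]
    linear_combination - (eval (g • v) (pderiv 1 f)) * hdet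
  · simp only [polyMap, hamiltonian, Fin.mk_one, Matrix.cons_val_zero, Matrix.cons_val_one,
      map_neg, h]
    linear_combination (eval (g • v) (pderiv 0 f)) * hdet

/-- For a finite group without orbits of length at most two on the projective line, any nonzero
invariant form yields a nontrivial self-compression. -/
theorem compression_of_invariant [IsAlgClosed k] [CharZero k] (G : Subgroup (PSL2 k))
    (hG : ∀ p : P1 k, 3 ≤ (MulAction.orbit G p).ncard) {f : MvPolynomial (Fin 2) k} {d : ℕ}
    (hd : d ≠ 0) (hf : f.IsHomogeneous (d + 1)) (hf0 : f ≠ 0)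
    (hinv : ∀ g ∈ binaryGroup G, subst g f = f) :
    ∃ F : Fin 2 → MvPolynomial (Fin 2) k,
      IsHomogeneousSelfCompression (binaryGroup G) d F ∧
      ∃ φ : P1 k → P1 k, IsDescent F φ ∧ IsNontrivialSelfCompression G φ := by
  have hinf : Infinite k := IsAlgClosed.instInfinite
  have hF := hamiltonian_isHomogeneous hf
  have hequiv : ∀ g ∈ binaryGroup G, ∀ v,
      polyMap (hamiltonian f) (g • v) = g • polyMap (hamiltonian f) v :=
    fun g hg => polyMap_hamiltonian_smul (hinv g hg)
  -- Euler's identity: pairing the Hamiltonian field with the position vector recovers f, so neither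
  -- the field nor the form `W` below can be zero.
  have heuler : X 1 * hamiltonian f 0 - X 0 * hamiltonian f 1 = (d + 1) • f := by
    rw [← hf.sum_X_mul_pderiv, Fin.sum_univ_two]
    simp only [hamiltonian, Matrix.cons_val_zero, Matrix.cons_val_one]
    ring
  have hne : (d + 1) • f ≠ 0 := by
    rw [nsmul_eq_mul]
    refine mul_ne_zero ?_ hf0
    exact_mod_cast d.succ_ne_zero
  obtain ⟨n, e, P, F₀, hPn, hP, hF₀, h, hPF⟩ := exists_factorization hF (by
    intro h0
    apply hne
    rw [← heuler, h0]
    simp)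
  refine ⟨hamiltonian f, compression_of_factorization G hF hequiv h hF₀ ?_ hd hPn hP hPF⟩
  by_contra! he
  set W := X 1 * F₀ 0 - X 0 * F₀ 1 with hW
  have hW0 : W ≠ 0 := by
    intro h0
    apply hne
    rw [← heuler, hPF, hPF]
    linear_combination P * h0
  have hWhom : W.IsHomogeneous (1 + e) :=
    ((isHomogeneous_X _ _).mul (hF₀ 0)).sub ((isHomogeneous_X _ _).mul (hF₀ 1))
  obtain ⟨v, hv, hWv⟩ := exists_nontrivial_zero hWhom (by lia)
  -- The zeros of `W` are the fixed points of the descent. They form a nonempty set stable under G,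
  -- of at most e + 1 ≤ 2 points under the assumption to be refuted.
  have hfix : ∀ p : P1 k, descent F₀ h p = p ↔ eval p.rep W = 0 := by
    intro p
    conv_lhs => rw [← p.mk_rep]
    rw [descent_mk h hF₀, mk_eq_mk_iff_wedge, hW]
    simp only [polyMap, eval_sub, eval_mul, eval_X]
    rw [mul_comm, mul_comm (eval p.rep (F₀ 1))]
  have hp0 : descent F₀ h (Projectivization.mk k v hv) = Projectivization.mk k v hv := by
    rw [descent_mk h hF₀, mk_eq_mk_iff_wedge]
    simp only [hW, eval_sub, eval_mul, eval_X] at hWv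
    simp only [polyMap]
    linear_combination hWv
  have hsub : MulAction.orbit G (Projectivization.mk k v hv) ⊆
      {p : P1 k | eval p.rep W = 0} := by
    rintro _ ⟨⟨g, hg⟩, rfl⟩
    rw [Set.mem_ofPred, ← hfix]
    obtain ⟨g, rfl⟩ := QuotientGroup.mk_surjective g
    have hmk : (⟨(QuotientGroup.mk g : PSL2 k), hg⟩ : G) • Projectivization.mk k v hv
        = g • Projectivization.mk k v hv := rfl
    dsimp only
    rw [hmk, descent_smul h hF₀ hP hPF (hequiv g hg), hp0]
  have h1 := Set.ncard_le_ncard hsub (finite_zeros hWhom hW0)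
  have h2 := ncard_zeros_le hWhom hW0
  have h3 := hG (Projectivization.mk k v hv)
  lia

end Gradient
end CremonaOne

namespace CremonaOne
open MulAction

/-! ### Counting orbits of an action whose nontrivial elements have two fixed points. -/

section TwoFixedPoints

/-- Every nontrivial element of `G` has exactly two fixed points in `X`, and all stabilizers are
cyclic. -/
structure HasTwoFixedPoints (G X : Type*) [Group G] [MulAction G X] : Prop where
  ncard_fixedBy : ∀ g : G, g ≠ 1 → (fixedBy X g).ncard = 2
  isCyclic_stabilizer : ∀ p : X, IsCyclic (stabilizer G p)

/-- The points with stabilizer of order `e`. -/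
def pointsOfOrder (G X : Type*) [Group G] [MulAction G X] (e : ℕ) : Set X :=
  {p | Nat.card (stabilizer G p) = e}

variable {G X : Type*} [Group G] [MulAction G X]

lemma card_stabilizer_mul_ncard_orbit (p : X) :
    Nat.card (stabilizer G p) * (orbit G p).ncard = Nat.card G := by
  rw [← index_stabilizer, Subgroup.card_mul_index]

lemma card_stabilizer_smul (g : G) (p : X) :
    Nat.card (stabilizer G (g • p)) = Nat.card (stabilizer G p) :=
  (Nat.card_congr (stabilizerEquivStabilizerOfOrbitRel (⟨g, rfl⟩ : orbitRel G X (g • p) p)).toEquiv)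

variable (G X) in
/-- The points with nontrivial stabilizer. -/
def specialPoints : SubMulAction G X where
  carrier := {p | stabilizer G p ≠ ⊥}
  smul_mem' g p hp := by
    have h := card_stabilizer_smul g p
    intro h0
    rw [h0, Subgroup.card_bot] at h
    exact hp (Subgroup.eq_bot_of_card_eq _ h.symm)

lemma mem_specialPoints {p : X} : p ∈ specialPoints G X ↔ stabilizer G p ≠ ⊥ := Iff.rfl

variable [Finite G]

lemma two_le_card_stabilizer {p : X} (hp : stabilizer G p ≠ ⊥) :
    2 ≤ Nat.card (stabilizer G p) :=
  (Subgroup.one_lt_card_iff_ne_bot _).2 hp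

/-- Several of the three orbits may contribute to the same order; in the tetrahedral case two orbits
have stabilizers of order three. -/
lemma ncard_pointsOfOrder {p : Fin 3 → X}
    (hp : ∀ x : X, stabilizer G x ≠ ⊥ → ∃ i, x ∈ orbit G (p i))
    (hdisj : ∀ i j, p i ∈ orbit G (p j) → i = j) {e : ℕ} (he : 2 ≤ e) :
    (pointsOfOrder G X e).ncard =
      ∑ i, if Nat.card (stabilizer G (p i)) = e then (orbit G (p i)).ncard else 0 := by
  classical
  have hfin : ∀ i, (orbit G (p i)).Finite := fun i => Set.finite_range _
  have hU : pointsOfOrder G X e =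
      ⋃ i, if Nat.card (stabilizer G (p i)) = e then orbit G (p i) else ∅ := by
    ext x
    simp only [Set.mem_iUnion, pointsOfOrder, Set.mem_ofPred]
    constructor
    · intro hx
      obtain ⟨i, g, rfl⟩ := hp x (fun h0 => by
        rw [h0, Subgroup.card_bot] at hx
        lia)
      refine ⟨i, ?_⟩
      dsimp only at hx
      rw [card_stabilizer_smul] at hx
      rw [if_pos hx]
      exact ⟨g, rfl⟩
    · rintro ⟨i, hi⟩
      split_ifs at hi with hc
      · obtain ⟨g, rfl⟩ := hi
        dsimp only
        rwa [card_stabilizer_smul]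
      · exact hi.elim
  have hd : Pairwise (Function.onFun Disjoint fun i =>
      if Nat.card (stabilizer G (p i)) = e then orbit G (p i) else (∅ : Set X)) := by
    intro i j hij
    rw [Function.onFun, Set.disjoint_left]
    intro x hx hy
    split_ifs at hx hy
    · refine hij (hdisj i j ?_)
      rw [← orbit_eq_iff.2 hy, orbit_eq_iff.2 hx]
      exact mem_orbit_self _
    all_goals first | exact hx.elim | exact hy.elim
  have hfin' : ∀ i, Set.Finite
      (if Nat.card (stabilizer G (p i)) = e then orbit G (p i) else (∅ : Set X)) := by
    intro i
    split_ifs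
    · exact hfin i
    · exact Set.finite_empty
  have := fun i => (hfin' i).to_subtype
  rw [hU, ← Nat.card_coe_set_eq, Nat.card_congr (Set.unionEqSigmaOfDisjoint hd), Nat.card_sigma]
  · refine Finset.sum_congr rfl fun i _ => ?_
    split_ifs <;> simp [Nat.card_coe_set_eq]

namespace HasTwoFixedPoints

variable (h : HasTwoFixedPoints G X)
include h

omit [Finite G] in
lemma finite_fixedBy {g : G} (hg : g ≠ 1) : (fixedBy X g).Finite :=
  Set.finite_of_ncard_ne_zero (by rw [h.ncard_fixedBy g hg]; lia)

lemma finite_specialPoints : (specialPoints G X : Set X).Finite := by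
  have hfin : (⋃ g ∈ {g : G | g ≠ 1}, fixedBy X g).Finite :=
    (Set.toFinite _).biUnion fun g hg => h.finite_fixedBy hg
  refine hfin.subset fun p hp => ?_
  obtain ⟨⟨g, hg⟩, hg1⟩ := Subgroup.ne_bot_iff_exists_ne_one.1 (mem_specialPoints.1 hp)
  have hg1' : g ≠ 1 := fun h1 => hg1 (Subtype.ext h1)
  exact Set.mem_biUnion hg1' hg

/-- Burnside's count on the finite set of special points: the identity fixes all of them, every
other element exactly two, and those two are special. -/
lemma burnside [Nontrivial G] :
    Nat.card (specialPoints G X) + 2 * (Nat.card G - 1) =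
      Nat.card (Quotient (orbitRel G (specialPoints G X))) * Nat.card G := by
  classical
  have : Finite (specialPoints G X) := h.finite_specialPoints
  have := Fintype.ofFinite (specialPoints G X)
  have := Fintype.ofFinite G
  have hb := sum_card_fixedBy_eq_card_orbits_mul_card_group G (specialPoints G X)
  simp only [Nat.card_eq_fintype_card]
  rw [← hb, ← Finset.add_sum_erase _ _ (Finset.mem_univ (1 : G))]
  congr 1
  · simp only [← Nat.card_eq_fintype_card, Nat.card_coe_set_eq, fixedBy_one_eq_univ,
      Set.ncard_univ]
  · rw [Finset.sum_congr rfl (g := fun _ => 2)]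
    · simp [Finset.card_erase_of_mem, mul_comm]
    · intro g hg
      have hg1 : g ≠ 1 := Finset.ne_of_mem_erase hg
      rw [← h.ncard_fixedBy g hg1, ← Nat.card_eq_fintype_card, ← Nat.card_coe_set_eq]
      refine Nat.card_congr ⟨fun x => ⟨x.1.1, congrArg Subtype.val x.2⟩,
        fun x => ⟨⟨x.1, ?_⟩, Subtype.ext x.2⟩, fun _ => rfl, fun _ => rfl⟩
      exact mem_specialPoints.2 (Subgroup.ne_bot_iff_exists_ne_one.2
        ⟨⟨g, x.2⟩, fun h1 => hg1 (congrArg Subtype.val h1)⟩)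

/-- Sorting the orbits by stabilizer order spares the later arithmetic the permuted cases. -/
lemma exists_orbit_representatives [Nontrivial G] :
    ∃ (r : ℕ) (p : Fin r → X), (∀ i, stabilizer G (p i) ≠ ⊥) ∧
      (∀ x : X, stabilizer G x ≠ ⊥ → ∃ i, x ∈ orbit G (p i)) ∧
      (∀ i j, p i ∈ orbit G (p j) → i = j) ∧
      (Monotone fun i => Nat.card (stabilizer G (p i))) ∧
      ∑ i, (orbit G (p i)).ncard + 2 * (Nat.card G - 1) = r * Nat.card G := by
  classical
  have : Finite (specialPoints G X) := h.finite_specialPoints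
  have := Fintype.ofFinite (specialPoints G X)
  have := Fintype.ofFinite G
  have hfin := Fintype.ofFinite (Quotient (orbitRel G (specialPoints G X)))
  have hb := h.burnside
  obtain ⟨r, ⟨φ⟩⟩ := Finite.exists_equiv_fin (Quotient (orbitRel G (specialPoints G X)))
  set q : Fin r → X := fun i => ((φ.symm i).out : specialPoints G X) with hq
  set σ := Tuple.sort fun i => Nat.card (stabilizer G (q i)) with hσ
  have hout : ∀ i, q i ∈ specialPoints G X := fun i => (φ.symm i).out.2
  refine ⟨r, q ∘ σ, fun i => hout _, ?_, ?_,
    Tuple.monotone_sort fun i => Nat.card (stabilizer G (q i)), ?_⟩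
  · intro x hx
    refine ⟨σ.symm (φ (Quotient.mk _ ⟨x, hx⟩)), ?_⟩
    simp only [hq, Function.comp, Equiv.apply_symm_apply, Equiv.symm_apply_apply]
    have := Quotient.mk_out (s := orbitRel G (specialPoints G X)) ⟨x, hx⟩
    have := (orbitRel G (specialPoints G X)).symm this
    obtain ⟨g, hg⟩ := this
    exact ⟨g, congrArg Subtype.val hg⟩
  · intro i j hij
    obtain ⟨g, hg⟩ := hij
    have : (φ.symm (σ i)) = φ.symm (σ j) := by
      rw [← Quotient.out_eq (φ.symm (σ i)), ← Quotient.out_eq (φ.symm (σ j))]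
      exact Quotient.sound ⟨g, Subtype.ext hg⟩
    simpa using this
  · have hcard : Nat.card (specialPoints G X) = ∑ i, (orbit G ((q ∘ σ) i)).ncard := by
      have h1 := Nat.card_congr (selfEquivSigmaOrbits G (specialPoints G X))
      rw [Nat.card_sigma] at h1
      rw [h1]
      refine Fintype.sum_equiv (φ.trans σ.symm) _ _ fun ω => ?_
      simp only [Function.comp, Equiv.trans_apply, Equiv.apply_symm_apply, hq,
        Equiv.symm_apply_apply]
      rw [← SubMulAction.val_image_orbit, Set.ncard_image_of_injective _ Subtype.val_injective,
        Nat.card_coe_set_eq]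
    rw [← hcard, hb, Nat.card_congr φ, Nat.card_fin]

end HasTwoFixedPoints
end TwoFixedPoints

/-- The solutions of the numerical equation satisfied by the orders `a ≤ b ≤ c` of the
stabilizers and the lengths `x`, `y`, `z` of three orbits. -/
lemma three_orbits_cases {N a b c x y z : ℕ} (ha : 2 ≤ a) (hab : a ≤ b) (hbc : b ≤ c)
    (hx : a * x = N) (hy : b * y = N) (hz : c * z = N) (hsum : x + y + z = N + 2) :
    (a = 2 ∧ b = 2 ∧ z = 2) ∨
    (a = 2 ∧ b = 3 ∧ c = 3 ∧ N = 12 ∧ x = 6 ∧ y = 4 ∧ z = 4) ∨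
    (a = 2 ∧ b = 3 ∧ c = 4 ∧ N = 24 ∧ x = 12 ∧ y = 8 ∧ z = 6) ∨
    (a = 2 ∧ b = 3 ∧ c = 5 ∧ N = 60 ∧ x = 30 ∧ y = 20 ∧ z = 12) := by
  -- The equation is 1/a + 1/b + 1/c = 1 + 2/N. The left side is at most 1 for (3, 3, 3), (2, 4, 4)
  -- and (2, 3, 6) and beyond, which bounds a, b and c in turn.
  have ha2 : a = 2 := by
    by_contra h
    have h1 : 3 * x ≤ a * x := Nat.mul_le_mul_right _ (by lia)
    have h2 : 3 * y ≤ b * y := Nat.mul_le_mul_right _ (by lia)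
    have h3 : 3 * z ≤ c * z := Nat.mul_le_mul_right _ (by lia)
    lia
  subst ha2
  have hb3 : b = 2 ∨ b = 3 := by
    by_contra! h
    have h2 : 4 * y ≤ b * y := Nat.mul_le_mul_right _ (by lia)
    have h3 : 4 * z ≤ c * z := Nat.mul_le_mul_right _ (by lia)
    lia
  rcases hb3 with rfl | rfl
  · left
    lia
  · right
    have hc : c ≤ 5 := by
      by_contra! h
      have h3 : 6 * z ≤ c * z := Nat.mul_le_mul_right _ (by lia)
      lia
    interval_cases c <;> lia

end CremonaOne

namespace CremonaOne
open MulAction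

/-! ### Numerical types of the actions, and normal subgroups with small orbits. -/

section Classification

variable {G X : Type*} [Group G] [MulAction G X] [Finite G]

/-- A group action with the orders of stabilizers and the numbers of special points of a
polyhedral rotation group: `e` is the order of the stabilizers of the vertices in the orbit of
length `|G| / e`, and the stabilizers have order at most `e`. -/
structure IsPolyhedralAction (G X : Type*) [Group G] [MulAction G X] (N e n₂ n₃ nₑ : ℕ) : Prop where
  card_eq : Nat.card G = N
  ncard_two : (pointsOfOrder G X 2).ncard = n₂
  ncard_three : (pointsOfOrder G X 3).ncard = n₃
  ncard_top : (pointsOfOrder G X e).ncard = nₑ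
  card_stabilizer : ∀ p : X, Nat.card (stabilizer G p) = 1 ∨ Nat.card (stabilizer G p) = 2 ∨
    Nat.card (stabilizer G p) = 3 ∨ Nat.card (stabilizer G p) = e

/-- Let r be the number of special orbits. Each has length at most N/2, so the orbit count forces r
≤ 3, and r ≤ 1 is impossible. For r = 2 the lengths add up to 2, so there is a fixed point; r = 3 is
`three_orbits_cases`. -/
theorem HasTwoFixedPoints.classification (h : HasTwoFixedPoints G X) [Nontrivial G] :
    (∃ p : X, stabilizer G p = ⊤) ∨
    (∃ p : X, 2 ≤ Nat.card (stabilizer G p) ∧ (orbit G p).ncard = 2) ∨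
    IsPolyhedralAction G X 12 3 6 8 8 ∨ IsPolyhedralAction G X 24 4 12 8 6 ∨
    IsPolyhedralAction G X 60 5 30 20 12 := by
  obtain ⟨r, p, hp, hcover, hdisj, hmono, hsum⟩ := h.exists_orbit_representatives
  have hN : 2 ≤ Nat.card G := Finite.one_lt_card
  have hmul := fun i => card_stabilizer_mul_ncard_orbit (G := G) (p i)
  have he := fun i => two_le_card_stabilizer (hp i)
  have hpos : ∀ i, 1 ≤ (orbit G (p i)).ncard := by
    intro i
    by_contra! h0
    have := hmul i
    rw [Nat.lt_one_iff.1 h0, mul_zero] at this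
    lia
  have hle : ∀ i, 2 * (orbit G (p i)).ncard ≤ Nat.card G := by
    intro i
    rw [← hmul i]
    exact Nat.mul_le_mul_right _ (he i)
  have hr : r ≤ 3 := by
    have h1 : ∑ i, 2 * (orbit G (p i)).ncard ≤ ∑ _i : Fin r, Nat.card G :=
      Finset.sum_le_sum fun i _ => hle i
    rw [← Finset.mul_sum, Finset.sum_const, Finset.card_univ, Fintype.card_fin, smul_eq_mul] at h1
    by_contra! h4
    have h2 : 4 * Nat.card G ≤ r * Nat.card G := Nat.mul_le_mul_right _ h4
    lia
  interval_cases r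
  · simp at hsum
    lia
  · have := hpos 0
    simp at hsum
    lia
  · left
    have h0 := hpos 0
    have h1 := hpos 1
    rw [Fin.sum_univ_two] at hsum
    have h2 : (orbit G (p 0)).ncard = 1 := by lia
    refine ⟨p 0, Subgroup.eq_top_of_card_eq _ ?_⟩
    have := hmul 0
    rwa [h2, mul_one] at this
  · right
    rw [Fin.sum_univ_three] at hsum
    have hO : ∀ e, 2 ≤ e → (pointsOfOrder G X e).ncard = _ := fun e he =>
      ncard_pointsOfOrder hcover hdisj he
    simp only [Fin.sum_univ_three] at hO
    have hcard : ∀ x : X, Nat.card (stabilizer G x) = 1 ∨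
        Nat.card (stabilizer G x) = Nat.card (stabilizer G (p 0)) ∨
        Nat.card (stabilizer G x) = Nat.card (stabilizer G (p 1)) ∨
        Nat.card (stabilizer G x) = Nat.card (stabilizer G (p 2)) := by
      intro x
      by_cases hx : stabilizer G x = ⊥
      · left
        rw [hx, Subgroup.card_bot]
      · right
        obtain ⟨i, g, rfl⟩ := hcover x hx
        dsimp only
        rw [card_stabilizer_smul]
        fin_cases i <;> simp
    rcases three_orbits_cases (he 0) (hmono (show (0 : Fin 3) ≤ 1 by decide))
      (hmono (show (1 : Fin 3) ≤ 2 by decide)) (hmul 0) (hmul 1) (hmul 2) (by lia) with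
      ⟨-, -, hz⟩ | ⟨ha, hb, hc, hn, hx, hy, hz⟩ | ⟨ha, hb, hc, hn, hx, hy, hz⟩ |
        ⟨ha, hb, hc, hn, hx, hy, hz⟩
    · exact Or.inl ⟨p 2, he 2, hz⟩
    all_goals simp only [ha, hb, hc, hx, hy, hz] at hO hcard
    · refine Or.inr (Or.inl ⟨hn, ?_, ?_, ?_, fun x => by have := hcard x; lia⟩)
      all_goals rw [hO _ (by norm_num)]; norm_num
    · refine Or.inr (Or.inr (Or.inl ⟨hn, ?_, ?_, ?_, fun x => by have := hcard x; lia⟩))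
      all_goals rw [hO _ (by norm_num)]; norm_num
    · refine Or.inr (Or.inr (Or.inr ⟨hn, ?_, ?_, ?_, fun x => by have := hcard x; lia⟩))
      all_goals rw [hO _ (by norm_num)]; norm_num

variable (h : HasTwoFixedPoints G X)
include h

-- An element of the cyclic stabilizer of p commutes with g, hence permutes the two fixed points of
-- g; fixing one of them, it fixes the other.
omit [Finite G] in
lemma HasTwoFixedPoints.stabilizer_eq {g : G} (hg : g ≠ 1) {p q : X} (hp : g • p = p)
    (hq : g • q = q) : stabilizer G p = stabilizer G q := by
  have key : ∀ {p q : X}, g • p = p → g • q = q → stabilizer G p ≤ stabilizer G q := by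
    intro p q hp hq x hx
    by_cases hpq : q = p
    · rwa [hpq]
    have hcyc := h.isCyclic_stabilizer p
    have hcomm : x * g = g * x := by
      have := (IsCyclic.isMulCommutative (α := stabilizer G p)).is_comm.comm ⟨x, hx⟩ ⟨g, hp⟩
      exact congrArg Subtype.val this
    have hxq : x • q ∈ fixedBy X g := by
      rw [mem_fixedBy, ← mul_smul, ← hcomm, mul_smul, hq]
    obtain ⟨a, b, -, hab⟩ := Set.ncard_eq_two.1 (h.ncard_fixedBy g hg)
    have hxp : x • p = p := hx
    have h1 : p ∈ ({a, b} : Set X) := hab ▸ hp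
    have h2 : q ∈ ({a, b} : Set X) := hab ▸ hq
    rw [hab] at hxq
    have hne : x • q ≠ p := fun h0 => hpq (by
      rw [← hxp] at h0
      exact smul_left_cancel _ h0)
    simp only [Set.mem_insert_iff, Set.mem_singleton_iff] at h1 h2 hxq
    rw [mem_stabilizer_iff]
    grind
  exact le_antisymm (key hp hq) (key hq hp)

omit [Finite G] in
/-- A normal subgroup that fixes a point is trivial unless the orbit of the point has length at
most two. -/
lemma HasTwoFixedPoints.ncard_orbit_le_two {K : Subgroup G} [hK : K.Normal] (hne : K ≠ ⊥) {p : X}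
    (hKp : K ≤ stabilizer G p) : (orbit G p).ncard ≤ 2 := by
  obtain ⟨⟨c, hc⟩, hc1⟩ := Subgroup.ne_bot_iff_exists_ne_one.1 hne
  have hc1' : c ≠ 1 := fun h1 => hc1 (Subtype.ext h1)
  rw [← h.ncard_fixedBy c hc1']
  refine Set.ncard_le_ncard ?_ (h.finite_fixedBy hc1')
  rintro _ ⟨g, rfl⟩
  -- The conjugates of c also lie in K and fix p, so c fixes the whole orbit of p.
  have h1 := hKp (hK.conj_mem c hc g⁻¹)
  rw [mem_stabilizer_iff, inv_inv, mul_smul, mul_smul, inv_smul_eq_iff] at h1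
  exact h1

end Classification
end CremonaOne

namespace CremonaOne
open MulAction

/-! ### The action on the Sylow 3-subgroups in the tetrahedral and octahedral cases. -/

section Sylow

variable {G X : Type*} [Group G] [MulAction G X] [Finite G]

lemma card_sylow_of_card_eq {p : ℕ} [hp : Fact p.Prime] (P : Sylow p G) {a m : ℕ}
    (hm : ¬ p ∣ m) (hG : Nat.card G = p ^ a * m) : Nat.card P = p ^ a := by
  have hm0 : m ≠ 0 := by
    rintro rfl
    simp at hm
  have h := P.card_eq_multiplicity
  rwa [hG, Nat.factorization_mul (pow_ne_zero _ hp.out.ne_zero) hm0, hp.out.factorization_pow,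
    Finsupp.add_apply, Finsupp.single_eq_same, Nat.factorization_eq_zero_of_not_dvd hm,
    add_zero] at h

omit [Finite G] in
lemma ker_toPermHom_sylow_le {p : ℕ} [Fact p.Prime] (P : Sylow p G) :
    (toPermHom G (Sylow p G)).ker ≤ Subgroup.normalizer (P : Set G) := fun _ hg =>
  Sylow.smul_eq_iff_mem_normalizer.1 (DFunLike.congr_fun (MonoidHom.mem_ker.1 hg) P)

omit [Finite G] in
/-- If the kernel of the conjugation action on the Sylow `p`-subgroups contains one of them, there
is only one of them. -/
lemma sylow_eq_of_le_ker {p : ℕ} [Fact p.Prime] {Q : Sylow p G}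
    (hQ : (Q : Subgroup G) ≤ (toPermHom G (Sylow p G)).ker) (P : Sylow p G) : P = Q := by
  have h := Q.isPGroup'.inf_normalizer_sylow P
  rw [inf_eq_left.2 (hQ.trans (ker_toPermHom_sylow_le P))] at h
  have hle : (Q : Subgroup G) ≤ P := inf_eq_left.1 h.symm
  exact Sylow.ext (Q.is_maximal' P.isPGroup' hle)

lemma card_ker_toPermHom_sylow_dvd {p : ℕ} [Fact p.Prime] {n m : ℕ} (hn : n ≠ 0)
    (hcard : Nat.card (Sylow p G) = n)
    (hG : Nat.card G = n * m) : Nat.card (toPermHom G (Sylow p G)).ker ∣ m := by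
  obtain ⟨P⟩ : Nonempty (Sylow p G) := inferInstance
  have h1 := P.card_eq_index_normalizer
  have h2 := (Subgroup.normalizer (P : Set G)).card_mul_index
  rw [← h1, hcard, hG, mul_comm] at h2
  rw [← Nat.eq_of_mul_eq_mul_left (Nat.pos_of_ne_zero hn) h2]
  exact Subgroup.card_dvd_of_le (ker_toPermHom_sylow_le P)

lemma exists_sylow_le_ker_of_dvd {p : ℕ} [hp : Fact p.Prime] {m : ℕ} (hm : ¬ p ∣ m)
    (hG : Nat.card G = p ^ 1 * m) {K : Subgroup G} (hK : p ∣ Nat.card K) :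
    ∃ Q : Sylow p G, (Q : Subgroup G) ≤ K := by
  obtain ⟨⟨c, hcK⟩, hc⟩ := exists_prime_orderOf_dvd_card' p hK
  rw [Subgroup.orderOf_mk] at hc
  have hz : Nat.card (Subgroup.zpowers c) = p ^ 1 := by
    rw [Nat.card_zpowers, hc, pow_one]
  obtain ⟨Q, hQ⟩ := (IsPGroup.of_card hz).exists_le_sylow
  refine ⟨Q, ?_⟩
  rw [← Subgroup.eq_of_le_of_card_ge hQ (by rw [hz, card_sylow_of_card_eq Q hm hG])]
  simpa using hcK

variable (h : HasTwoFixedPoints G X)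
include h

omit [Finite G] in
lemma HasTwoFixedPoints.exists_fixed {g : G} (hg : g ≠ 1) : ∃ x : X, g • x = x := by
  have h2 := h.ncard_fixedBy g hg
  obtain ⟨x, hx⟩ := Set.nonempty_of_ncard_ne_zero (s := fixedBy X g) (by lia)
  exact ⟨x, hx⟩

-- A fixed point of a generator is fixed by all of K. This rules out normal subgroups of prime order
-- when all orbits are long.
omit [Finite G] in
lemma HasTwoFixedPoints.ncard_orbit_le_two_of_prime {K : Subgroup G} [K.Normal] {p : ℕ}
    [hp : Fact p.Prime] (hK : Nat.card K = p) : ∃ x : X, (orbit G x).ncard ≤ 2 := by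
  have hne : K ≠ ⊥ := by
    rintro rfl
    rw [Subgroup.card_bot] at hK
    exact hp.out.one_lt.ne hK
  obtain ⟨⟨c, hc⟩, hc1⟩ := Subgroup.ne_bot_iff_exists_ne_one.1 hne
  obtain ⟨x, hx⟩ := h.exists_fixed (g := c) fun h1 => hc1 (Subtype.ext h1)
  refine ⟨x, h.ncard_orbit_le_two hne fun g hg => ?_⟩
  obtain ⟨n, hn⟩ := mem_zpowers_of_prime_card hK (g := ⟨c, hc⟩) (g' := ⟨g, hg⟩) hc1
  have : c ^ n = g := congrArg Subtype.val hn
  rw [← this]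
  exact Subgroup.zpow_mem _ (show c ∈ stabilizer G x from hx) n

/-- A single Sylow 3-subgroup would be the stabilizer of every point of order three, and its
nontrivial elements would fix more than two points. So the number of these subgroups, congruent to 1
modulo 3 and dividing 4m, is 4. The kernel of the action has order dividing 3m; the order is prime
to 3, for otherwise the kernel would contain a Sylow subgroup, and it is not 2, for otherwise there
would be an orbit of length at most two. -/
lemma HasTwoFixedPoints.sylow_three {m : ℕ} (hm : m = 1 ∨ m = 2)
    (hG : Nat.card G = 4 * (3 * m)) (h3 : 2 < (pointsOfOrder G X 3).ncard)
    (hst : ∀ x : X, Nat.card (stabilizer G x) ≤ 4) :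
    Nat.card (Sylow 3 G) = 4 ∧ Function.Injective (toPermHom G (Sylow 3 G)) := by
  have : Fact (Nat.Prime 3) := ⟨Nat.prime_three⟩
  have : Fact (Nat.Prime 2) := ⟨Nat.prime_two⟩
  have hG' : Nat.card G = 3 ^ 1 * (4 * m) := by lia
  have hm3 : ¬ 3 ∣ 4 * m := by lia
  have hcard : ∀ P : Sylow 3 G, Nat.card P = 3 := fun P => card_sylow_of_card_eq P hm3 hG'
  have hne : ∀ Q : Sylow 3 G, ¬ ∀ P : Sylow 3 G, P = Q := by
    intro Q hQ
    have hstab : ∀ x ∈ pointsOfOrder G X 3, stabilizer G x = Q := by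
      intro x hx
      have hx3 : Nat.card (stabilizer G x) = 3 := hx
      obtain ⟨P, hP⟩ := (IsPGroup.of_card (p := 3) (n := 1) hx3).exists_le_sylow
      rw [← hQ P]
      exact Subgroup.eq_of_le_of_card_ge hP (by rw [hx3]; exact (hcard P).le)
    have hQ1 : (Q : Subgroup G) ≠ ⊥ := by
      intro h0
      have := hcard Q
      rw [h0, Subgroup.card_bot] at this
      lia
    obtain ⟨⟨c, hc⟩, hc1⟩ := Subgroup.ne_bot_iff_exists_ne_one.1 hQ1
    have hc1' : c ≠ 1 := fun h1 => hc1 (Subtype.ext h1)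
    have := Set.ncard_le_ncard (s := pointsOfOrder G X 3) (t := fixedBy X c) (fun x hx => by
      have : c ∈ stabilizer G x := by rw [hstab x hx]; exact hc
      exact this) (h.finite_fixedBy hc1')
    rw [h.ncard_fixedBy c hc1'] at this
    lia
  have hn4 : Nat.card (Sylow 3 G) = 4 := by
    obtain ⟨P⟩ : Nonempty (Sylow 3 G) := inferInstance
    have h1 : Nat.card (Sylow 3 G) % 3 = 1 := card_sylow_modEq_one 3 G
    have h2 := P.card_dvd_index
    have h3 : (P : Subgroup G).index = 4 * m := by
      have h4 := (P : Subgroup G).card_mul_index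
      rw [show Nat.card (P : Subgroup G) = 3 from hcard P] at h4
      lia
    rw [h3] at h2
    have h5 : Nat.card (Sylow 3 G) ≠ 1 := by
      intro h6
      have := (Nat.card_eq_one_iff_unique.1 h6).1
      exact hne P fun Q => Subsingleton.elim _ _
    have h7 := Nat.le_of_dvd (by lia) h2
    have h8 : 4 * m ≤ 8 := by lia
    generalize Nat.card (Sylow 3 G) = n at *
    rcases hm with rfl | rfl
    · interval_cases n <;> lia
    · interval_cases n <;> lia
  refine ⟨hn4, ?_⟩
  rw [← MonoidHom.ker_eq_bot_iff]
  set K := (toPermHom G (Sylow 3 G)).ker with hK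
  have hK3 : ¬ 3 ∣ Nat.card K := by
    intro h0
    obtain ⟨Q, hQ⟩ := exists_sylow_le_ker_of_dvd hm3 hG' h0
    exact hne Q (sylow_eq_of_le_ker hQ)
  have hKd : Nat.card K ∣ 3 * m := card_ker_toPermHom_sylow_dvd (by lia) hn4 hG
  have hK2 : Nat.card K ≠ 2 := by
    intro h0
    obtain ⟨x, hx⟩ := h.ncard_orbit_le_two_of_prime h0
    have h1 := card_stabilizer_mul_ncard_orbit (G := G) x
    have h2 := Nat.mul_le_mul (hst x) hx
    lia
  apply Subgroup.eq_bot_of_card_eq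
  have h7 := Nat.le_of_dvd (by lia) hKd
  have h8 : 0 < Nat.card K := Nat.card_pos
  generalize Nat.card K = n at *
  rcases hm with rfl | rfl
  · interval_cases n <;> lia
  · interval_cases n <;> lia

end Sylow

/-! ### Recognising symmetric and alternating groups by order. -/

section Embedding

variable {G : Type*} [Group G] [Finite G]

omit [Finite G] in
lemma nonempty_mulEquiv_perm {Y : Type*} [Finite Y] {n : ℕ} (hY : Nat.card Y = n)
    {φ : G →* Equiv.Perm Y} (hφ : Function.Injective φ) (hG : Nat.card G = n.factorial) :
    Nonempty (G ≃* Equiv.Perm (Fin n)) := by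
  obtain ⟨e⟩ : Nonempty (Y ≃ Fin n) := by
    rw [← hY]
    exact ⟨Finite.equivFin Y⟩
  have hinj : Function.Injective (e.permCongrHom.toMonoidHom.comp φ) :=
    e.permCongrHom.injective.comp hφ
  refine ⟨MulEquiv.ofBijective (e.permCongrHom.toMonoidHom.comp φ) ?_⟩
  rw [Nat.bijective_iff_injective_and_card]
  exact ⟨hinj, by rw [hG, Nat.card_perm, Nat.card_fin]⟩

lemma nonempty_mulEquiv_alternatingGroup {Y : Type*} [Finite Y] {n : ℕ} (hY : Nat.card Y = n)
    {φ : G →* Equiv.Perm Y} (hφ : Function.Injective φ) (hG : 2 * Nat.card G = n.factorial) :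
    Nonempty (G ≃* alternatingGroup (Fin n)) := by
  obtain ⟨e⟩ : Nonempty (Y ≃ Fin n) := by
    rw [← hY]
    exact ⟨Finite.equivFin Y⟩
  have hinj : Function.Injective (e.permCongrHom.toMonoidHom.comp φ) :=
    e.permCongrHom.injective.comp hφ
  have hindex : (e.permCongrHom.toMonoidHom.comp φ).range.index = 2 := by
    have h1 := (e.permCongrHom.toMonoidHom.comp φ).range.card_mul_index
    rw [Nat.card_perm, Nat.card_fin, ← hG, ← Nat.card_congr (MonoidHom.ofInjective hinj).toEquiv,
      mul_comm 2] at h1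
    exact Nat.eq_of_mul_eq_mul_left Nat.card_pos h1
  exact ⟨(MonoidHom.ofInjective hinj).trans
    (MulEquiv.subgroupCongr (Equiv.Perm.eq_alternatingGroup_of_index_eq_two hindex))⟩

end Embedding
end CremonaOne

namespace CremonaOne
open MulAction

/-! ### The action on the five Sylow 2-subgroups in the icosahedral case. -/

section Icosahedral

variable {G X : Type*} [Group G] [MulAction G X] [Finite G]
variable (h : HasTwoFixedPoints G X)

omit [Finite G] in
lemma smul_of_commute {t g : G} (htg : g * t = t * g) {x : X} (hx : t • x = x) :
    t • (g • x) = g • x := by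
  rw [← mul_smul, ← htg, mul_smul, hx]

include h in
/-- If the stabilizer of a point has order two, its centralizer has order at most four. -/
lemma HasTwoFixedPoints.card_centralizer_le {t : G} (ht : t ≠ 1) {x : X} (hx : t • x = x)
    (hx2 : Nat.card (stabilizer G x) = 2) :
    Nat.card (Subgroup.centralizer ({t} : Set G)) ≤ 4 := by
  set C := Subgroup.centralizer ({t} : Set G)
  have h1 := card_stabilizer_mul_ncard_orbit (G := C) x
  have h2 : (orbit C x).ncard ≤ 2 := by
    rw [← h.ncard_fixedBy t ht]
    refine Set.ncard_le_ncard ?_ (h.finite_fixedBy ht)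
    rintro _ ⟨⟨g, hg⟩, rfl⟩
    exact smul_of_commute (Subgroup.mem_centralizer_singleton_iff.1 hg) hx
  have h3 : Nat.card (stabilizer C x) ≤ 2 := by
    rw [← hx2]
    exact Nat.card_le_card_of_injective (fun g => (⟨g.1.1, g.2⟩ : stabilizer G x))
      fun a b hab => Subtype.ext (Subtype.ext
        (show a.1.1 = b.1.1 from congrArg (fun z : stabilizer G x => (z : G)) hab))
  have := Nat.mul_le_mul h3 h2
  lia

-- A group of order four is abelian, so P lies in the centralizer of t, which has no more than four
-- elements. Hence P is the only Sylow 2-subgroup containing t.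
include h in
lemma HasTwoFixedPoints.sylow_two_eq_centralizer {P : Sylow 2 G} (hP : Nat.card P = 4) {t : G}
    (ht : t ≠ 1) (htP : t ∈ P) {x : X} (hx : t • x = x)
    (hx2 : Nat.card (stabilizer G x) = 2) :
    (P : Subgroup G) = Subgroup.centralizer ({t} : Set G) := by
  have : Fact (Nat.Prime 2) := ⟨Nat.prime_two⟩
  have hcomm := IsPGroup.isMulCommutative_of_card_eq_prime_sq (p := 2) (G := P) (by rw [hP]; rfl)
  refine Subgroup.eq_of_le_of_card_ge (fun g hg => ?_)
    ((h.card_centralizer_le ht hx hx2).trans hP.ge)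
  rw [Subgroup.mem_centralizer_singleton_iff]
  exact congrArg Subtype.val (hcomm.is_comm.comm ⟨g, hg⟩ ⟨t, htP⟩)

include h in
lemma HasTwoFixedPoints.sylow_two (hG : IsPolyhedralAction G X 60 5 30 20 12) :
    Nat.card (Sylow 2 G) = 5 ∧ Function.Injective (toPermHom G (Sylow 2 G)) := by
  have : Fact (Nat.Prime 2) := ⟨Nat.prime_two⟩
  have : Fact (Nat.Prime 3) := ⟨Nat.prime_three⟩
  have hcard : ∀ P : Sylow 2 G, Nat.card P = 4 := fun P =>
    card_sylow_of_card_eq (a := 2) (m := 15) P (by lia) (by rw [hG.card_eq]; rfl)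
  -- The order of t divides 4 and the order of the stabilizer, which is 1, 2, 3 or 5.
  have hstab : ∀ (P : Sylow 2 G) (t : G) (x : X), t ∈ P → t ≠ 1 → t • x = x →
      Nat.card (stabilizer G x) = 2 := by
    intro P t x ht ht1 hx
    have h1 : orderOf t ∣ 4 := by
      rw [← hcard P, ← Subgroup.orderOf_mk t ht]
      exact orderOf_dvd_natCard _
    have h2 : orderOf t ∣ Nat.card (stabilizer G x) := by
      rw [← Subgroup.orderOf_mk t (show t ∈ stabilizer G x from hx)]
      exact orderOf_dvd_natCard _
    have h3 : orderOf t ≠ 1 := by rwa [Ne, orderOf_eq_one_iff]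
    have h4 := Nat.dvd_gcd h1 h2
    rcases hG.card_stabilizer x with hc | hc | hc | hc
    · rw [hc] at h4
      exact absurd (Nat.dvd_one.1 h4) h3
    · exact hc
    · rw [hc] at h4
      exact absurd (Nat.dvd_one.1 h4) h3
    · rw [hc] at h4
      exact absurd (Nat.dvd_one.1 h4) h3
  have hn : Nat.card (Sylow 2 G) = 5 := by
    have hfix : ∀ P : Sylow 2 G, ∀ t : {t : P // t ≠ 1}, Nat.card (fixedBy X (t : G)) = 2 := by
      intro P t
      rw [Nat.card_coe_set_eq]
      exact h.ncard_fixedBy _ fun h1 => t.2 (Subtype.ext h1)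
    have hfin : ∀ P : Sylow 2 G, ∀ t : {t : P // t ≠ 1}, Finite (fixedBy X (t : G)) :=
      fun P t => Nat.finite_of_card_ne_zero (by rw [hfix P t]; lia)
    have hne : ∀ P : Sylow 2 G, Nat.card {t : P // t ≠ 1} = 3 := by
      intro P
      classical
      have := Fintype.ofFinite P
      rw [Nat.card_eq_fintype_card, Fintype.card_subtype_compl, Fintype.card_subtype_eq,
        ← Nat.card_eq_fintype_card]
      exact congrArg (· - 1) (hcard P)
    -- Double count of triples (P, t, x) with t a nontrivial element of P fixing x. The point x
    -- determines t, the only involution in its stabilizer, and t determines P as its centralizer.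
    -- With n subgroups this gives n · 3 · 2 = 30.
    have hbij : Nat.card (Σ P : Sylow 2 G, Σ t : {t : P // t ≠ 1}, fixedBy X (t : G)) =
        Nat.card (pointsOfOrder G X 2) := by
      refine Nat.card_eq_of_bijective (fun y => ⟨y.2.2.1, hstab y.1 y.2.1 _ y.2.1.1.2
        (fun h1 => y.2.1.2 (Subtype.ext h1)) y.2.2.2⟩) ⟨?_, ?_⟩
      · rintro ⟨P, ⟨⟨t, htP⟩, ht⟩, ⟨x, hx⟩⟩ ⟨P', ⟨⟨t', htP'⟩, ht'⟩, ⟨x', hx'⟩⟩ hxx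
        obtain rfl : x = x' := congrArg Subtype.val hxx
        have ht1 : t ≠ 1 := fun h1 => ht (Subtype.ext h1)
        have ht1' : t' ≠ 1 := fun h1 => ht' (Subtype.ext h1)
        have hx2 := hstab P t x htP ht1 hx
        have htt : t = t' := by
          obtain ⟨a, b, hab, huniv⟩ := Nat.card_eq_two_iff.1 hx2
          have e1 := huniv ▸ Set.mem_univ (1 : stabilizer G x)
          have e2 := huniv ▸ Set.mem_univ (⟨t, hx⟩ : stabilizer G x)
          have e3 := huniv ▸ Set.mem_univ (⟨t', hx'⟩ : stabilizer G x)
          have n2 : (⟨t, hx⟩ : stabilizer G x) ≠ 1 := fun h1 => ht1 (congrArg Subtype.val h1)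
          have n3 : (⟨t', hx'⟩ : stabilizer G x) ≠ 1 := fun h1 => ht1' (congrArg Subtype.val h1)
          have : (⟨t, hx⟩ : stabilizer G x) = ⟨t', hx'⟩ := by
            simp only [Set.mem_insert_iff, Set.mem_singleton_iff] at e1 e2 e3
            grind
          exact congrArg Subtype.val this
        subst htt
        obtain rfl : P = P' := Sylow.ext
          ((h.sylow_two_eq_centralizer (hcard P) ht1 htP hx hx2).trans
            (h.sylow_two_eq_centralizer (hcard P') ht1 htP' hx hx2).symm)
        rfl
      · rintro ⟨x, hx⟩
        have hx2 : Nat.card (stabilizer G x) = 2 := hx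
        obtain ⟨P, hP⟩ := (IsPGroup.of_card (p := 2) (n := 1) hx2).exists_le_sylow
        have hne1 : stabilizer G x ≠ ⊥ := by
          intro h0
          rw [h0, Subgroup.card_bot] at hx2
          lia
        obtain ⟨⟨t, htx⟩, ht⟩ := Subgroup.ne_bot_iff_exists_ne_one.1 hne1
        have ht1 : t ≠ 1 := fun h1 => ht (Subtype.ext h1)
        exact ⟨⟨P, ⟨⟨t, hP htx⟩, fun h1 => ht1 (congrArg (fun z : P => (z : G)) h1)⟩,
          ⟨x, htx⟩⟩, rfl⟩
    classical
    have := Fintype.ofFinite (Sylow 2 G)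
    have := fun P : Sylow 2 G => Fintype.ofFinite {t : P // t ≠ 1}
    rw [Nat.card_coe_set_eq, hG.ncard_two, Nat.card_sigma] at hbij
    simp only [Nat.card_sigma, hfix, Finset.sum_const, Finset.card_univ,
      ← Nat.card_eq_fintype_card, hne, smul_eq_mul] at hbij
    lia
  refine ⟨hn, ?_⟩
  rw [← MonoidHom.ker_eq_bot_iff]
  set K := (toPermHom G (Sylow 2 G)).ker with hK
  have hne : ∀ Q : Sylow 2 G, ¬ ∀ P : Sylow 2 G, P = Q := by
    intro Q hQ
    have := Nat.card_eq_one_iff_exists.2 ⟨Q, hQ⟩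
    lia
  have hKd : Nat.card K ∣ 12 :=
    card_ker_toPermHom_sylow_dvd (by lia) hn (by rw [hG.card_eq])
  have hK2 : ¬ 2 ∣ Nat.card K := by
    intro h0
    obtain ⟨⟨t, htK⟩, ht⟩ := exists_prime_orderOf_dvd_card' 2 h0
    rw [Subgroup.orderOf_mk] at ht
    have ht1 : t ≠ 1 := by
      rintro rfl
      simp at ht
    have hz : Nat.card (Subgroup.zpowers t) = 2 ^ 1 := by
      rw [Nat.card_zpowers, ht, pow_one]
    obtain ⟨P, hP⟩ := (IsPGroup.of_card hz).exists_le_sylow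
    obtain ⟨x, hx⟩ := h.exists_fixed ht1
    have hx2 := hstab P t x (hP (Subgroup.mem_zpowers t)) ht1 hx
    have hstabx : stabilizer G x ≤ K := by
      rw [← Subgroup.eq_of_le_of_card_ge (H := Subgroup.zpowers t) (K := stabilizer G x)
        (by simpa using hx) (by rw [hz, hx2]; norm_num)]
      simpa using htK
    -- The 30 points of order two form one orbit, so their stabilizers are conjugate. As soon as the
    -- normal subgroup K contains one of them, it contains all, and hence a whole Sylow 2-subgroup.
    have horbit : orbit G x = pointsOfOrder G X 2 := by
      have hsub : orbit G x ⊆ pointsOfOrder G X 2 := by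
        rintro _ ⟨g, rfl⟩
        exact (card_stabilizer_smul g x).trans hx2
      refine Set.eq_of_subset_of_ncard_le hsub ?_
        (Set.finite_of_ncard_ne_zero (by rw [hG.ncard_two]; lia))
      have := card_stabilizer_mul_ncard_orbit (G := G) x
      rw [hG.card_eq, hx2] at this
      rw [hG.ncard_two]
      lia
    refine hne P (sylow_eq_of_le_ker fun s hs => ?_)
    by_cases hs1 : s = 1
    · rw [hs1]
      exact one_mem _
    obtain ⟨y, hy⟩ := h.exists_fixed hs1
    have hy2 : y ∈ pointsOfOrder G X 2 := hstab P s y hs hs1 hy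
    rw [← horbit] at hy2
    obtain ⟨g, rfl⟩ := hy2
    have hmem : g⁻¹ * s * g ∈ stabilizer G x := by
      dsimp only at hy
      rw [mem_stabilizer_iff, mul_smul, mul_smul, hy, inv_smul_smul]
    have hconj := (inferInstance : K.Normal).conj_mem _ (hstabx hmem) g
    have : g * (g⁻¹ * s * g) * g⁻¹ = s := by group
    rwa [this] at hconj
  have hK3 : Nat.card K ≠ 3 := by
    intro h0
    obtain ⟨x, hx⟩ := h.ncard_orbit_le_two_of_prime h0
    have h1 := card_stabilizer_mul_ncard_orbit (G := G) x
    have h2 : Nat.card (stabilizer G x) ≤ 5 := by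
      have := hG.card_stabilizer x
      lia
    have h2 := Nat.mul_le_mul h2 hx
    rw [h1, hG.card_eq] at h2
    lia
  apply Subgroup.eq_bot_of_card_eq
  have h7 := Nat.le_of_dvd (by lia) hKd
  have h8 : 0 < Nat.card K := Nat.card_pos
  generalize Nat.card K = n at *
  interval_cases n <;> lia

end Icosahedral

/-! ### Recognising dihedral groups. -/

section Dihedral

/-- A finite group generated by a cyclic subgroup of index two and involutions outside it is
dihedral. -/
lemma nonempty_mulEquiv_dihedralGroup {G : Type*} [Group G] [Finite G] {C : Subgroup G}
    [hC : IsCyclic C] (hindex : C.index = 2) (hinv : ∀ g ∉ C, g * g = 1) :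
    Nonempty (G ≃* DihedralGroup (Nat.card C)) := by
  obtain ⟨⟨c, hcC⟩, hc⟩ := hC.exists_generator
  have hord : orderOf c = Nat.card C := by
    rw [← Subgroup.orderOf_mk c hcC]
    exact orderOf_eq_card_of_forall_mem_zpowers hc
  have hCz : ∀ g ∈ C, ∃ n : ℤ, c ^ n = g := by
    intro g hg
    obtain ⟨n, hn⟩ := hc ⟨g, hg⟩
    exact ⟨n, congrArg Subtype.val hn⟩
  obtain ⟨s, hs⟩ : ∃ s, s ∉ C := by
    by_contra! hall
    rw [(Subgroup.eq_top_iff' C).2 hall, Subgroup.index_top] at hindex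
    lia
  have hss := hinv s hs
  have hsC : ∀ g ∉ C, s * g ∈ C := by
    intro g hg
    have := (Subgroup.mul_mem_iff_of_index_two hindex (a := s) (b := g)).2 (by tauto)
    exact this
  -- Both s and s cⁿ lie outside C and are their own inverses, so s inverts cⁿ.
  have hcs : ∀ n : ℤ, s * c ^ n = c ^ (-n) * s := by
    intro n
    have h1 := hinv (s * c ^ n) fun h0 => hs ((Subgroup.mul_mem_cancel_right _
      (C.zpow_mem hcC n)).1 h0)
    have h2 : s * c ^ n = (s * c ^ n)⁻¹ := eq_inv_of_mul_eq_one_left h1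
    rw [h2, mul_inv_rev, ← zpow_neg, inv_eq_of_mul_eq_one_left hss]
  set l := Nat.card C with hl
  have : NeZero l := ⟨Nat.card_pos.ne'⟩
  set ρ : ZMod l → G := fun i => c ^ (i.val : ℤ) with hρ
  have hρint : ∀ n : ℤ, ρ (n : ZMod l) = c ^ n := by
    intro n
    rw [hρ]
    dsimp only
    rw [zpow_eq_zpow_iff_modEq, hord, ← ZMod.intCast_eq_intCast_iff]
    simp
  have hρadd : ∀ i j, ρ (i + j) = ρ i * ρ j := by
    intro i j
    have : ρ (i + j) = c ^ (i.val : ℤ) * c ^ (j.val : ℤ) := by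
      simpa only [zpow_add, Int.cast_add, Int.cast_natCast, ZMod.natCast_zmod_val] using
        hρint (i.val + j.val)
    exact this
  have hρneg : ∀ i, ρ (-i) = (ρ i)⁻¹ := by
    intro i
    have : ρ (-i) = (c ^ (i.val : ℤ))⁻¹ := by
      simpa only [zpow_neg, Int.cast_neg, Int.cast_natCast, ZMod.natCast_zmod_val] using
        hρint (-(i.val : ℤ))
    exact this
  have hsρ : ∀ i, s * ρ i = ρ (-i) * s := by
    intro i
    rw [hρneg, hρ]
    dsimp only
    rw [hcs, zpow_neg]
  let f : DihedralGroup l →* G :=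
    { toFun := fun x => match x with
        | .r i => ρ i
        | .sr i => s * ρ i
      map_one' := by
        rw [DihedralGroup.one_def]
        simp [hρ]
      map_mul' := by
        rintro (i | i) (j | j)
        · exact hρadd i j
        · change s * ρ (j - i) = ρ i * (s * ρ j)
          rw [← mul_assoc, ← neg_neg i, ← hsρ, mul_assoc, ← hρadd, neg_neg, sub_eq_neg_add]
        · change s * ρ (i + j) = s * ρ i * ρ j
          rw [hρadd, mul_assoc]
        · change ρ (j - i) = s * ρ i * (s * ρ j)
          rw [hsρ, mul_assoc, ← mul_assoc s s, hss, one_mul, ← hρadd, sub_eq_neg_add] }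
  have hsurj : Function.Surjective f := by
    intro g
    by_cases hg : g ∈ C
    · obtain ⟨n, rfl⟩ := hCz g hg
      exact ⟨.r n, hρint n⟩
    · obtain ⟨n, hn⟩ := hCz _ (hsC g hg)
      refine ⟨.sr n, ?_⟩
      change s * ρ n = g
      rw [hρint, hn, ← mul_assoc, hss, one_mul]
  have hcardG : Nat.card G = 2 * l := by
    rw [← C.card_mul_index, hindex, mul_comm]
  refine ⟨(MulEquiv.ofBijective f ?_).symm⟩
  rw [Nat.bijective_iff_surjective_and_card]
  exact ⟨hsurj, by rw [hcardG, DihedralGroup.nat_card]⟩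

variable {G X : Type*} [Group G] [MulAction G X] [Finite G]

/-- If a point has an orbit of length two and a nontrivial stabilizer, the other point of the orbit
has the same stabilizer and all the elements outside it are involutions. -/
lemma HasTwoFixedPoints.orbit_two (h : HasTwoFixedPoints G X) {p : X}
    (hp : (orbit G p).ncard = 2) (hst : 2 ≤ Nat.card (stabilizer G p)) :
    ∀ g ∉ stabilizer G p, stabilizer G (g • p) = stabilizer G p ∧ g • g • p = p ∧ g * g = 1 := by
  intro g hg
  have hne : stabilizer G p ≠ ⊥ := by
    intro h0
    rw [h0, Subgroup.card_bot] at hst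
    lia
  have hindex : (stabilizer G p).index = 2 := by rw [index_stabilizer, hp]
  have hnormal := Subgroup.normal_of_index_eq_two hindex
  have hgp : g • p ≠ p := hg
  have hstab : stabilizer G (g • p) = stabilizer G p := by
    refine (Subgroup.eq_of_le_of_card_ge (fun x hx => ?_) (card_stabilizer_smul g p).le).symm
    have h1 := hnormal.conj_mem x hx g⁻¹
    rw [mem_stabilizer_iff, inv_inv, mul_smul, mul_smul, inv_smul_eq_iff] at h1
    exact h1
  have hggp : g • g • p = p := by
    rw [← mul_smul]
    exact Subgroup.mul_self_mem_of_index_two hindex g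
  refine ⟨hstab, hggp, ?_⟩
  -- If g² ≠ 1, then g² fixes p and also a fixed point x of g. The two points then have the same
  -- stabilizer, so g fixes p.
  by_contra hgg
  have hg1 : g ≠ 1 := by
    rintro rfl
    simp at hgg
  obtain ⟨x, hx⟩ := h.exists_fixed hg1
  have hxx : (g * g) • x = x := by rw [mul_smul, hx, hx]
  have hpp : (g * g) • p = p := by rw [mul_smul, hggp]
  have hstx := h.stabilizer_eq hgg hxx hpp
  exact hg (hstx ▸ (show g ∈ stabilizer G x from hx))

end Dihedral
end CremonaOne

namespace CremonaOne
open MvPolynomial MulAction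

/-! ### Elements of finite order of PSL₂: eigenvectors and fixed points. -/

section FixedPoints

variable {k : Type*} [Field k]

lemma wedge_ne_zero_of_mk_ne {v w : Fin 2 → k} (hv : v ≠ 0) (hw : w ≠ 0)
    (h : Projectivization.mk k v hv ≠ Projectivization.mk k w hw) : v 0 * w 1 - v 1 * w 0 ≠ 0 :=
  fun h0 => h ((mk_eq_mk_iff_wedge hv hw).2 h0)

lemma exists_eq_smul_of_wedge_eq_zero {v w : Fin 2 → k} (hv : v ≠ 0)
    (h : v 0 * w 1 - v 1 * w 0 = 0) : ∃ c : k, w = c • v := by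
  by_cases hw : w = 0
  · exact ⟨0, by rw [hw, zero_smul]⟩
  · have := (mk_eq_mk_iff_wedge hw hv).2 (by linear_combination -h)
    rw [Projectivization.mk_eq_mk_iff'] at this
    obtain ⟨c, hc⟩ := this
    exact ⟨c, hc.symm⟩

lemma smul_mk_eq_iff {A : SL2 k} {v : Fin 2 → k} (hv : v ≠ 0) :
    A • Projectivization.mk k v hv = Projectivization.mk k v hv ↔ ∃ c : k, A • v = c • v := by
  rw [Projectivization.smul_mk, Projectivization.mk_eq_mk_iff']
  exact exists_congr fun c => eq_comm

lemma mk_smul_mk (A : SL2 k) (p : P1 k) : (QuotientGroup.mk A : PSL2 k) • p = A • p := rfl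

/-- For an element with an eigenvector `v`, the induced map modulo `v` is the inverse eigenvalue. -/
lemma smul_eq_of_eigenvector {A : SL2 k} {v : Fin 2 → k} (hv : v ≠ 0) {c : k} (hc : c ≠ 0)
    (hA : A • v = c • v) (w : Fin 2 → k) : ∃ b : k, A • w = c⁻¹ • w + b • v := by
  have h := wedge_smul A v w
  rw [hA] at h
  obtain ⟨b, hb⟩ := exists_eq_smul_of_wedge_eq_zero (v := v) (w := A • w - c⁻¹ • w) hv (by
    simp only [Pi.smul_apply, smul_eq_mul, Pi.sub_apply] at h ⊢
    apply mul_left_cancel₀ hc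
    field_simp
    linear_combination h)
  exact ⟨b, by rw [← hb]; abel⟩

lemma eigenvalue_ne_zero {A : SL2 k} {v : Fin 2 → k} (hv : v ≠ 0) {c : k}
    (hA : A • v = c • v) : c ≠ 0 := by
  rintro rfl
  rw [zero_smul] at hA
  exact hv (by rw [← inv_smul_smul A v, hA, smul_zero])

lemma pow_smul_eigenvector {A : SL2 k} {v : Fin 2 → k} {c : k} (hA : A • v = c • v) (n : ℕ) :
    A ^ n • v = c ^ n • v := by
  induction n with
  | zero => simp
  | succ n ih => rw [pow_succ, mul_smul, hA, smul_comm, ih, smul_smul, pow_succ, mul_comm]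

lemma eigenvalue_pow_eq_one {A : SL2 k} {v : Fin 2 → k} (hv : v ≠ 0) {c : k} (hA : A • v = c • v)
    {n : ℕ} (hn : A ^ n = 1) : c ^ n = 1 := by
  have h := pow_smul_eigenvector hA n
  rw [hn, one_smul] at h
  by_contra hc
  have h2 : (c ^ n - 1) • v = 0 := by rw [sub_smul, one_smul, ← h, sub_self]
  rcases smul_eq_zero.1 h2 with h3 | h3
  · exact hc (sub_eq_zero.1 h3)
  · exact hv h3

/-- An element of finite order with eigenvalue `±1` is a scalar. -/
lemma smul_eq_of_sq_eq_one [CharZero k] {A : SL2 k} {v : Fin 2 → k} (hv : v ≠ 0) {c : k}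
    (hc : c * c = 1) (hA : A • v = c • v) {n : ℕ} (hn0 : n ≠ 0) (hn : A ^ n = 1)
    (w : Fin 2 → k) : A • w = c • w := by
  have hc0 : c ≠ 0 := by
    rintro rfl
    simp at hc
  have hcinv : c⁻¹ = c := inv_eq_of_mul_eq_one_left hc
  obtain ⟨b, hb⟩ := smul_eq_of_eigenvector hv hc0 hA w
  rw [hcinv] at hb
  -- In essence Aᵐw = cᵐw + m cᵐ⁻¹ b v, multiplied by c to avoid the exponent m − 1. Finite order
  -- then gives nb = 0, and b = 0 in characteristic zero.
  have key : ∀ m : ℕ, c • A ^ m • w = c ^ (m + 1) • w + ((m : k) * c ^ m * b) • v := by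
    intro m
    induction m with
    | zero => simp
    | succ m ih =>
      have h1 : c • A ^ (m + 1) • w = A • (c • A ^ m • w) := by
        rw [pow_succ', mul_smul, smul_comm A c]
      rw [h1, ih, smul_add, smul_comm A, smul_comm A, hb, hA]
      ext i
      simp only [Pi.add_apply, Pi.smul_apply, smul_eq_mul]
      push_cast
      ring
  have h2 := key n
  rw [hn, one_smul, pow_succ, eigenvalue_pow_eq_one hv hA hn, one_mul, mul_one] at h2
  have h3 : ((n : k) * b) • v = 0 := by
    simpa using h2
  have h4 : b = 0 := by
    simpa [hv, hn0] using h3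
  rw [hb, h4, zero_smul, add_zero]

lemma mul_self_eq_one_of_mem_center {z : SL2 k} (hz : z ∈ Subgroup.center (SL2 k)) :
    z * z = 1 := by
  obtain ⟨r, hr, hz⟩ := Matrix.SpecialLinearGroup.mem_center_iff.1 hz
  apply Subtype.ext
  rw [Fintype.card_fin] at hr
  rw [Matrix.SpecialLinearGroup.coe_mul, ← hz, ← map_mul, ← sq, hr, map_one,
    Matrix.SpecialLinearGroup.coe_one]

/-- Lifting to SL₂ costs a factor of two, since central elements square to 1. This is the source of
the factor 2 in the divisibility conditions on stabilizer orders. -/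
lemma pow_two_mul_eq_one {A : SL2 k} {e : ℕ} (h : (QuotientGroup.mk A : PSL2 k) ^ e = 1) :
    A ^ (2 * e) = 1 := by
  rw [← QuotientGroup.mk_pow, QuotientGroup.eq_one_iff] at h
  rw [two_mul, pow_add, mul_self_eq_one_of_mem_center h]

lemma pow_card_stabilizer_eq_one {G : Subgroup (PSL2 k)} {A : SL2 k} (hA : A ∈ binaryGroup G)
    {p : P1 k} (hp : A • p = p) : A ^ (2 * Nat.card (stabilizer G p)) = 1 := by
  apply pow_two_mul_eq_one
  have h : (⟨⟨QuotientGroup.mk A, hA⟩, hp⟩ : stabilizer G p) ^ Nat.card (stabilizer G p) = 1 :=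
    pow_card_eq_one'
  exact congrArg (fun z : stabilizer G p => ((z : G) : PSL2 k)) h

lemma eq_one_of_forall_smul_eq {g : PSL2 k} (h : ∀ p : P1 k, g • p = p) : g = 1 :=
  FaithfulSMul.eq_of_smul_eq_smul (α := P1 k) fun p => by rw [h p, one_smul]

/-- The quadratic form whose zeros are the fixed points of an element of `SL_2`. -/
noncomputable def fixedForm (A : SL2 k) : MvPolynomial (Fin 2) k :=
  X 0 * subst A (X 1) - X 1 * subst A (X 0)

lemma eval_fixedForm (A : SL2 k) (v : Fin 2 → k) :
    eval v (fixedForm A) = v 0 * (A • v) 1 - v 1 * (A • v) 0 := by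
  simp [fixedForm, eval_subst]

lemma fixedForm_isHomogeneous (A : SL2 k) : (fixedForm A).IsHomogeneous 2 := by
  have h : ∀ i, (subst A (X i)).IsHomogeneous 1 := by
    intro i
    simp only [subst, aeval_X]
    exact IsHomogeneous.sum _ _ _ fun j _ => isHomogeneous_C_mul_X _ _
  exact ((isHomogeneous_X _ _).mul (h 1)).sub ((isHomogeneous_X _ _).mul (h 0))

lemma smul_eq_iff_fixedForm (A : SL2 k) {v : Fin 2 → k} (hv : v ≠ 0) :
    A • Projectivization.mk k v hv = Projectivization.mk k v hv ↔ eval v (fixedForm A) = 0 := by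
  rw [Projectivization.smul_mk, mk_eq_mk_iff_wedge, eval_fixedForm, ← neg_eq_zero]
  ring_nf

/-- A nontrivial element of finite order of `PSL_2` has exactly two fixed points. -/
lemma ncard_fixedBy [IsAlgClosed k] [CharZero k] {g : PSL2 k} (hg : g ≠ 1) {n : ℕ} (hn : n ≠ 0)
    (hgn : g ^ n = 1) : (fixedBy (P1 k) g).ncard = 2 := by
  obtain ⟨A, rfl⟩ := QuotientGroup.mk_surjective g
  have hA := pow_two_mul_eq_one hgn
  have hfix : fixedBy (P1 k) (QuotientGroup.mk A : PSL2 k) =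
      {p : P1 k | eval p.rep (fixedForm A) = 0} := by
    ext p
    rw [Set.mem_ofPred, ← smul_eq_iff_fixedForm A p.rep_nonzero, p.mk_rep]
    rfl
  have hQ : fixedForm A ≠ 0 := by
    intro h0
    refine hg (eq_one_of_forall_smul_eq fun p => ?_)
    have : p ∈ fixedBy (P1 k) (QuotientGroup.mk A : PSL2 k) := by
      rw [hfix, Set.mem_ofPred, h0, map_zero]
    exact this
  have hle : (fixedBy (P1 k) (QuotientGroup.mk A : PSL2 k)).ncard ≤ 2 := by
    rw [hfix]
    exact ncard_zeros_le (fixedForm_isHomogeneous A) hQ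
  have hfin : (fixedBy (P1 k) (QuotientGroup.mk A : PSL2 k)).Finite := by
    rw [hfix]
    exact finite_zeros (fixedForm_isHomogeneous A) hQ
  refine le_antisymm hle ?_
  obtain ⟨v, hv, hv0⟩ := exists_nontrivial_zero (fixedForm_isHomogeneous A) two_ne_zero
  have hvfix := (smul_eq_iff_fixedForm A hv).2 hv0
  obtain ⟨c, hc⟩ := (smul_mk_eq_iff hv).1 hvfix
  have hc0 := eigenvalue_ne_zero hv hc
  -- For c = ±1 the element would be a scalar and act trivially. Hence c and c⁻¹ are distinct
  -- eigenvalues, and adding a multiple of v to u gives a second eigenvector.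
  have hcc : c * c ≠ 1 := by
    intro hcc
    refine hg (eq_one_of_forall_smul_eq fun p => ?_)
    rw [mk_smul_mk, ← p.mk_rep]
    exact (smul_mk_eq_iff p.rep_nonzero).2
      ⟨c, smul_eq_of_sq_eq_one hv hcc hc (mul_ne_zero two_ne_zero hn) hA _⟩
  obtain ⟨u, hu⟩ : ∃ u : Fin 2 → k, v 0 * u 1 - v 1 * u 0 ≠ 0 := by
    by_contra! h
    apply hv
    ext i
    fin_cases i
    · simpa using h ![0, 1]
    · simpa using h ![1, 0]
  obtain ⟨b, hb⟩ := smul_eq_of_eigenvector hv hc0 hc u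
  have hcc' : c⁻¹ - c ≠ 0 := by
    intro h0
    apply hcc
    have h1 : c * (c⁻¹ - c) = 0 := by rw [h0, mul_zero]
    rw [mul_sub, mul_inv_cancel₀ hc0] at h1
    linear_combination -h1
  obtain ⟨s, hs⟩ : ∃ s, s * (c⁻¹ - c) = b := ⟨b / (c⁻¹ - c), div_mul_cancel₀ _ hcc'⟩
  set w := u + s • v with hw
  have hwedge : v 0 * w 1 - v 1 * w 0 ≠ 0 := by
    convert hu using 1
    simp [hw]
    ring
  have hw0 : w ≠ 0 := by
    intro h0
    simp [h0] at hwedge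
  have hAw : A • w = c⁻¹ • w := by
    rw [hw, smul_add, hb, smul_comm A, hc]
    ext i
    simp only [Pi.add_apply, Pi.smul_apply, smul_eq_mul]
    linear_combination (-(v i)) * hs
  have hsub : ({Projectivization.mk k v hv, Projectivization.mk k w hw0} : Set (P1 k)) ⊆
      fixedBy (P1 k) (QuotientGroup.mk A : PSL2 k) := by
    rintro p (rfl | rfl)
    · exact hvfix
    · exact (smul_mk_eq_iff hw0).2 ⟨_, hAw⟩
  have hne : Projectivization.mk k v hv ≠ Projectivization.mk k w hw0 := by
    rw [Ne, mk_eq_mk_iff_wedge]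
    exact hwedge
  exact (Set.ncard_pair hne).ge.trans (Set.ncard_le_ncard hsub hfin)

/-- The stabilizers of points in a finite subgroup of `PSL_2` are cyclic. -/
lemma isCyclic_stabilizer [CharZero k] (G : Subgroup (PSL2 k)) [Finite G] (p : P1 k) :
    IsCyclic (stabilizer G p) := by
  set H : Subgroup (SL2 k) := binaryGroup G ⊓ stabilizer (SL2 k) p with hH
  have heig : ∀ A : H, ∃ c : k, (A : SL2 k) • p.rep = c • p.rep := by
    intro A
    rw [← smul_mk_eq_iff p.rep_nonzero, p.mk_rep]
    exact A.2.2
  choose f hf using heig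
  have huniq : ∀ {a b : k}, a • p.rep = b • p.rep → a = b := fun hab =>
    smul_left_injective k p.rep_nonzero hab
  -- The eigenvalue is a character of the preimage of the stabilizer. It is injective because an
  -- element of finite order with eigenvalue 1 is the identity, so the preimage is a finite group
  -- embedded in the units of a field, hence cyclic.
  let φ : H →* k :=
    { toFun := f
      map_one' := huniq (by rw [← hf, OneMemClass.coe_one, one_smul, one_smul])
      map_mul' := fun A B => huniq (by
        rw [← hf, Subgroup.coe_mul, mul_smul, hf B, smul_comm, hf A, smul_smul, mul_comm]) }
  set e := 2 * Nat.card (stabilizer G p) with he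
  have he0 : e ≠ 0 := mul_ne_zero two_ne_zero Nat.card_pos.ne'
  have hpow : ∀ A : H, (A : SL2 k) ^ e = 1 := fun A => pow_card_stabilizer_eq_one A.2.1 A.2.2
  have hinj : Function.Injective φ := by
    rw [injective_iff_map_eq_one]
    intro A hA
    have h1 : (A : SL2 k) • p.rep = (1 : k) • p.rep := by
      rw [hf A]
      exact congrArg (· • p.rep) hA
    have h2 := smul_eq_of_sq_eq_one p.rep_nonzero (mul_one 1) h1 he0 (hpow A)
    apply Subtype.ext
    apply Matrix.SpecialLinearGroup.ext
    intro i j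
    have h3 := congrFun (h2 (Pi.single j 1)) i
    rw [one_smul, Matrix.SpecialLinearGroup.smul_def, Matrix.smul_eq_mulVec,
      Matrix.mulVec_single_one] at h3
    simp only [Matrix.col_apply] at h3
    rw [h3, OneMemClass.coe_one, Matrix.SpecialLinearGroup.coe_one, Matrix.one_apply,
      Pi.single_apply]
  have hfin : Finite H := by
    have hroots : {x : k | x ^ e = 1}.Finite := by
      refine ((Polynomial.X ^ e - 1 : Polynomial k).rootSet_finite k).subset fun x hx => ?_
      rw [Polynomial.mem_rootSet]
      exact ⟨Polynomial.X_pow_sub_C_ne_zero (Nat.pos_of_ne_zero he0) 1, by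
        simpa [sub_eq_zero] using hx⟩
    have := hroots.to_subtype
    exact Finite.of_injective (fun A : H => (⟨φ A, by
      rw [Set.mem_ofPred, ← map_pow, show A ^ e = 1 from Subtype.ext (hpow A), map_one]⟩ :
        {x : k | x ^ e = 1})) fun A B hAB => hinj (congrArg Subtype.val hAB)
  have hcyc : IsCyclic H := isCyclic_of_injective_ringHom φ hinj
  let ψ : H →* stabilizer G p :=
    { toFun := fun A => ⟨⟨QuotientGroup.mk (A : SL2 k), A.2.1⟩, A.2.2⟩
      map_one' := rfl
      map_mul' := fun _ _ => rfl }
  refine isCyclic_of_surjective ψ ?_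
  rintro ⟨⟨g, hg⟩, hgp⟩
  obtain ⟨A, rfl⟩ := QuotientGroup.mk_surjective g
  exact ⟨⟨A, hg, hgp⟩, rfl⟩

theorem hasTwoFixedPoints [IsAlgClosed k] [CharZero k] (G : Subgroup (PSL2 k)) [Finite G] :
    HasTwoFixedPoints G (P1 k) where
  ncard_fixedBy g hg := by
    have hg1 : (g : PSL2 k) ≠ 1 := fun h => hg (Subtype.ext h)
    exact ncard_fixedBy hg1 (Nat.card_pos (α := G)).ne' (by
      rw [← Subgroup.coe_pow, pow_card_eq_one', Subgroup.coe_one])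
  isCyclic_stabilizer := isCyclic_stabilizer G

end FixedPoints
end CremonaOne

namespace CremonaOne
open MvPolynomial MulAction

/-! ### Semi-invariants attached to stable sets of points, and their characters. -/

section OrbitProduct

variable {k : Type*} [Field k]

/-- The linear form with the given zero on the projective line. -/
noncomputable def linearForm (v : Fin 2 → k) : MvPolynomial (Fin 2) k :=
  C (v 0) * X 1 - C (v 1) * X 0

lemma eval_linearForm (v w : Fin 2 → k) :
    eval w (linearForm v) = v 0 * w 1 - v 1 * w 0 := by
  simp [linearForm]

lemma linearForm_isHomogeneous (v : Fin 2 → k) : (linearForm v).IsHomogeneous 1 :=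
  (isHomogeneous_C_mul_X _ _).sub (isHomogeneous_C_mul_X _ _)

lemma linearForm_ne_zero {v : Fin 2 → k} (hv : v ≠ 0) : linearForm v ≠ 0 := by
  intro h
  apply hv
  ext i
  fin_cases i
  · simpa [h] using (eval_linearForm v ![0, 1]).symm
  · simpa [h] using (eval_linearForm v ![1, 0]).symm

lemma linearForm_smul (c : k) (v : Fin 2 → k) : linearForm (c • v) = C c * linearForm v := by
  simp [linearForm]
  ring

lemma subst_linearForm [Infinite k] (A : SL2 k) (v : Fin 2 → k) :
    subst A (linearForm v) = linearForm (A⁻¹ • v) := by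
  refine MvPolynomial.funext fun w => ?_
  rw [eval_subst, eval_linearForm, eval_linearForm, ← wedge_smul A (A⁻¹ • v) w, smul_inv_smul]

/-- The product of the linear forms vanishing at the points of a finite set. -/
noncomputable def pointsForm (O : Finset (P1 k)) : MvPolynomial (Fin 2) k :=
  ∏ p ∈ O, linearForm p.rep

lemma pointsForm_isHomogeneous (O : Finset (P1 k)) : (pointsForm O).IsHomogeneous O.card := by
  have := IsHomogeneous.prod O (fun p => linearForm p.rep) (fun _ => 1)
    fun p _ => linearForm_isHomogeneous p.rep
  rw [pointsForm]
  simpa using this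

lemma pointsForm_ne_zero (O : Finset (P1 k)) : pointsForm O ≠ 0 :=
  Finset.prod_ne_zero_iff.2 fun p _ => linearForm_ne_zero p.rep_nonzero

lemma eval_pointsForm_ne_zero {O : Finset (P1 k)} {v : Fin 2 → k} (hv : v ≠ 0)
    (h : Projectivization.mk k v hv ∉ O) : eval v (pointsForm O) ≠ 0 := by
  rw [pointsForm, eval_prod, Finset.prod_ne_zero_iff]
  intro p hp
  rw [eval_linearForm]
  refine wedge_ne_zero_of_mk_ne p.rep_nonzero hv ?_
  rw [p.mk_rep]
  rintro rfl
  exact h hp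

lemma exists_rep_smul (A : SL2 k) (p : P1 k) :
    ∃ c : k, c ≠ 0 ∧ A • p.rep = c • (A • p).rep := by
  have h : Projectivization.mk k (A • p).rep (A • p).rep_nonzero =
      Projectivization.mk k (A • p.rep) ((smul_ne_zero_iff_ne A).2 p.rep_nonzero) := by
    rw [(A • p).mk_rep, ← Projectivization.smul_mk A p.rep_nonzero, p.mk_rep]
  obtain ⟨c, hc⟩ := (Projectivization.mk_eq_mk_iff' _ _ _ _ _).1 h.symm
  refine ⟨c, ?_, hc.symm⟩
  rintro rfl
  rw [zero_smul] at hc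
  exact (smul_ne_zero_iff_ne A).2 p.rep_nonzero hc.symm

/-- The form attached to a stable set of points is a semi-invariant. -/
lemma exists_subst_pointsForm [Infinite k] {A : SL2 k} {O : Finset (P1 k)}
    (hO : ∀ p ∈ O, A⁻¹ • p ∈ O) : ∃ c : k, subst A (pointsForm O) = C c * pointsForm O := by
  classical
  choose f hf0 hf using fun p : P1 k => exists_rep_smul A⁻¹ p
  refine ⟨∏ p ∈ O, f p, ?_⟩
  rw [pointsForm, map_prod, map_prod]
  simp only [subst_linearForm, hf, linearForm_smul, Finset.prod_mul_distrib]
  congr 1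
  have hinj : Function.Injective fun p : P1 k => A⁻¹ • p := MulAction.injective A⁻¹
  have himage : O.image (fun p => A⁻¹ • p) = O :=
    Finset.eq_of_subset_of_card_le (Finset.image_subset_iff.2 hO)
      (by rw [Finset.card_image_of_injective _ hinj])
  conv_rhs => rw [← himage, Finset.prod_image hinj.injOn]

/-- The character of the form attached to a stable set of points that does not contain the point
of an eigenvector. -/
lemma subst_pointsForm_of_notMem [Infinite k] {A : SL2 k} {O : Finset (P1 k)}
    (hO : ∀ p ∈ O, A⁻¹ • p ∈ O) {v : Fin 2 → k} (hv : v ≠ 0) {c : k} (hA : A • v = c • v)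
    (h : Projectivization.mk k v hv ∉ O) :
    subst A (pointsForm O) = C (c ^ O.card) * pointsForm O := by
  obtain ⟨a, ha⟩ := exists_subst_pointsForm hO
  -- The character is read off at the eigenvector v, where the form does not vanish.
  have h1 := congrArg (eval v) ha
  rw [eval_subst, hA, eval_smul_of_isHomogeneous (pointsForm_isHomogeneous O), eval_mul,
    eval_C] at h1
  rw [ha, mul_right_cancel₀ (eval_pointsForm_ne_zero hv h) h1]

lemma subst_linearForm_eigenvector [Infinite k] {A : SL2 k} {v : Fin 2 → k} (hv : v ≠ 0) {c : k}
    (hA : A • v = c • v) : subst A (linearForm v) = C c⁻¹ * linearForm v := by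
  have hc := eigenvalue_ne_zero hv hA
  rw [subst_linearForm, ← linearForm_smul]
  congr 1
  rw [inv_smul_eq_iff, smul_comm, hA, smul_smul, inv_mul_cancel₀ hc, one_smul]

/-- The character of the form attached to a stable set of points that contains both fixed
points. -/
lemma subst_pointsForm_of_mem [Infinite k] {A : SL2 k} {O : Finset (P1 k)}
    (hO : ∀ p ∈ O, A⁻¹ • p ∈ O) {p q : P1 k} (hpq : p ≠ q) (hp : p ∈ O) (hq : q ∈ O)
    {c : k} (hAp : A • p.rep = c • p.rep) (hAq : A • q = q) :
    subst A (pointsForm O) = C (c ^ (O.card - 2)) * pointsForm O := by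
  classical
  have hc := eigenvalue_ne_zero p.rep_nonzero hAp
  have hpfix : A • p = p := by
    conv_lhs => rw [← p.mk_rep]
    rw [(smul_mk_eq_iff p.rep_nonzero).2 ⟨c, hAp⟩, p.mk_rep]
  have hq' : A • q.rep = c⁻¹ • q.rep := by
    rw [← q.mk_rep, smul_mk_eq_iff] at hAq
    obtain ⟨b, hb⟩ := hAq
    have h := wedge_smul A p.rep q.rep
    have hne := wedge_ne_zero_of_mk_ne p.rep_nonzero q.rep_nonzero (by
      rwa [p.mk_rep, q.mk_rep])
    rw [hAp, hb] at h
    simp only [Pi.smul_apply, smul_eq_mul] at h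
    have : c * b = 1 := by
      apply mul_right_cancel₀ hne
      linear_combination h
    rw [hb, eq_inv_of_mul_eq_one_right this]
  -- The linear factors at p and q contribute c⁻¹ and c, which cancel; the remaining |O| − 2 points
  -- avoid the eigenvector at p.
  set O' := (O.erase p).erase q with hO'
  have hqe : q ∈ O.erase p := Finset.mem_erase.2 ⟨hpq.symm, hq⟩
  have hsplit : pointsForm O = linearForm p.rep * (linearForm q.rep * pointsForm O') := by
    rw [pointsForm, pointsForm, hO', Finset.mul_prod_erase _ (fun p => linearForm p.rep) hqe,
      Finset.mul_prod_erase _ (fun p => linearForm p.rep) hp]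
  have hstab : ∀ r ∈ O', A⁻¹ • r ∈ O' := by
    intro r hr
    simp only [hO', Finset.mem_erase] at hr ⊢
    refine ⟨fun h0 => hr.1 ?_, fun h0 => hr.2.1 ?_, hO r hr.2.2⟩
    · rw [inv_smul_eq_iff.1 h0, hAq]
    · rw [inv_smul_eq_iff.1 h0, hpfix]
  have hcard : O'.card = O.card - 2 := by
    rw [hO', Finset.card_erase_of_mem hqe, Finset.card_erase_of_mem hp]
    lia
  have h1 := subst_pointsForm_of_notMem hstab p.rep_nonzero hAp (by
    rw [p.mk_rep]
    simp [hO'])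
  rw [hsplit, map_mul, map_mul, h1, subst_linearForm_eigenvector p.rep_nonzero hAp,
    subst_linearForm_eigenvector q.rep_nonzero hq', inv_inv, hcard]
  have : (C c⁻¹ * C c : MvPolynomial (Fin 2) k) = 1 := by
    rw [← C_mul, inv_mul_cancel₀ hc, C_1]
  linear_combination (linearForm p.rep * linearForm q.rep * C (c ^ (O.card - 2)) *
    pointsForm O') * this

/-- A power of the form attached to the points whose stabilizers have prescribed orders is
invariant under a finite group, under divisibility conditions on the number of these points. -/
theorem subst_pointsForm_pow [IsAlgClosed k] [CharZero k] (G : Subgroup (PSL2 k)) [Finite G]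
    [Nontrivial G] {O : Finset (P1 k)} {E : Set ℕ} {m : ℕ}
    (hO : ∀ p : P1 k, p ∈ O ↔ Nat.card (stabilizer G p) ∈ E)
    (hin : ∀ p ∈ O, stabilizer G p ≠ ⊥ → 2 * Nat.card (stabilizer G p) ∣ m * (O.card - 2))
    (hout : ∀ p ∉ O, stabilizer G p ≠ ⊥ → 2 * Nat.card (stabilizer G p) ∣ m * O.card) :
    ∀ A ∈ binaryGroup G, subst A (pointsForm O ^ m) = pointsForm O ^ m := by
  have hinf : Infinite k := IsAlgClosed.instInfinite
  have h := hasTwoFixedPoints G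
  -- The two fixed points p and q have equal stabilizers and membership in O depends only on the
  -- stabilizer order, so O contains both or neither. The eigenvalue at p is a root of unity of
  -- order dividing 2|stabilizer|.
  have key : ∀ A ∈ binaryGroup G, ∀ p : P1 k, stabilizer G p ≠ ⊥ → A • p = p →
      (∃ q, q ≠ p ∧ A • q = q ∧ stabilizer G q = stabilizer G p) →
      subst A (pointsForm O ^ m) = pointsForm O ^ m := by
    rintro A hA p hp hAp ⟨q, hqp, hAq, hst⟩
    have hstable : ∀ r ∈ O, A⁻¹ • r ∈ O := by
      intro r hr
      rw [hO] at hr ⊢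
      have := card_stabilizer_smul (⟨QuotientGroup.mk A, hA⟩⁻¹ : G) r
      rw [← this] at hr
      exact hr
    obtain ⟨c, hc⟩ := (smul_mk_eq_iff p.rep_nonzero).1 (by rwa [p.mk_rep])
    have hce := eigenvalue_pow_eq_one p.rep_nonzero hc (pow_card_stabilizer_eq_one hA hAp)
    have hpow : ∀ n, 2 * Nat.card (stabilizer G p) ∣ n → c ^ n = 1 := by
      rintro _ ⟨n, rfl⟩
      rw [pow_mul, hce, one_pow]
    by_cases hpO : p ∈ O
    · have hqO : q ∈ O := by
        rw [hO, hst, ← hO]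
        exact hpO
      rw [map_pow, subst_pointsForm_of_mem hstable hqp.symm hpO hqO hc hAq, mul_pow, ← C_pow,
        ← pow_mul, mul_comm _ m, hpow _ (hin p hpO hp), C_1, one_mul]
    · rw [map_pow, subst_pointsForm_of_notMem hstable p.rep_nonzero hc (by rwa [p.mk_rep]),
        mul_pow, ← C_pow, ← pow_mul, mul_comm _ m, hpow _ (hout p hpO hp), C_1, one_mul]
  have hpair : ∀ g : G, g ≠ 1 → ∃ p q : P1 k, q ≠ p ∧ g • p = p ∧ g • q = q := by
    intro g hg
    obtain ⟨a, b, hab, hfix⟩ := Set.ncard_eq_two.1 (h.ncard_fixedBy g hg)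
    have ha : a ∈ fixedBy (P1 k) g := by rw [hfix]; simp
    have hb : b ∈ fixedBy (P1 k) g := by rw [hfix]; simp
    exact ⟨a, b, hab.symm, ha, hb⟩
  have hne : ∀ g : G, g ≠ 1 → ∀ p : P1 k, g • p = p → stabilizer G p ≠ ⊥ := fun g hg p hp =>
    (Subgroup.ne_bot_iff_exists_ne_one).2 ⟨⟨g, hp⟩, fun h1 => hg (congrArg Subtype.val h1)⟩
  intro A hA
  by_cases hA1 : (⟨QuotientGroup.mk A, hA⟩ : G) = 1
  -- A acts trivially, so it may borrow the fixed points of any nontrivial element.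
  · obtain ⟨g, hg⟩ := exists_ne (1 : G)
    obtain ⟨p, q, hqp, hp, hq⟩ := hpair g hg
    have hfix : ∀ r : P1 k, A • r = r := by
      intro r
      have : (⟨QuotientGroup.mk A, hA⟩ : G) • r = r := by rw [hA1, one_smul]
      exact this
    exact key A hA p (hne g hg p hp) (hfix p) ⟨q, hqp, hfix q, h.stabilizer_eq hg hq hp⟩
  · obtain ⟨p, q, hqp, hp, hq⟩ := hpair _ hA1
    exact key A hA p (hne _ hA1 p hp) hp ⟨q, hqp, hq, h.stabilizer_eq hA1 hq hp⟩

end OrbitProduct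
end CremonaOne

namespace CremonaOne
open MvPolynomial MulAction

/-! ### Invariant forms of the groups of each type, and the resulting compressions. -/

section Invariants

variable {k : Type*} [Field k]

/-- There is a nonzero form of degree `n` invariant under the preimage of `G` in `SL_2`. -/
def HasInvariant (G : Subgroup (PSL2 k)) (n : ℕ) : Prop :=
  ∃ f : MvPolynomial (Fin 2) k, f ≠ 0 ∧ f.IsHomogeneous n ∧ ∀ A ∈ binaryGroup G, subst A f = f

lemma HasInvariant.add {G : Subgroup (PSL2 k)} {m n : ℕ} (hm : HasInvariant G m)
    (hn : HasInvariant G n) : HasInvariant G (m + n) := by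
  obtain ⟨f, hf0, hf, hfA⟩ := hm
  obtain ⟨g, hg0, hg, hgA⟩ := hn
  exact ⟨f * g, mul_ne_zero hf0 hg0, hf.mul hg, fun A hA => by rw [map_mul, hfA A hA, hgA A hA]⟩

lemma HasInvariant.mul_right {G : Subgroup (PSL2 k)} {m : ℕ} (hm : HasInvariant G m) (n : ℕ) :
    HasInvariant G (m * n) := by
  obtain ⟨f, hf0, hf, hfA⟩ := hm
  exact ⟨f ^ n, pow_ne_zero n hf0, hf.pow n, fun A hA => by rw [map_pow, hfA A hA]⟩

lemma IsPolyhedralAction.three_le_ncard_orbit {G : Subgroup (PSL2 k)} {N e n₂ n₃ nₑ : ℕ} (hN : 2 * e < N) (he : 3 ≤ e)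
    (h : IsPolyhedralAction G (P1 k) N e n₂ n₃ nₑ) (p : P1 k) : 3 ≤ (orbit G p).ncard := by
  have h1 := card_stabilizer_mul_ncard_orbit (G := G) p
  rw [h.card_eq] at h1
  by_contra! h2
  have h3 : Nat.card (stabilizer G p) ≤ e := by
    have := h.card_stabilizer p
    lia
  have := Nat.mul_le_mul h3 (Nat.le_of_lt_succ h2)
  lia

/-- The preimage of `G` in `SL_2` has a homogeneous self-compression of degree `d` whose descent is
a nontrivial self-compression of `G`. -/
def HasCompression (G : Subgroup (PSL2 k)) (d : ℕ) : Prop :=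
  ∃ F : Fin 2 → MvPolynomial (Fin 2) k, IsHomogeneousSelfCompression (binaryGroup G) d F ∧
    ∃ f : P1 k → P1 k, IsDescent F f ∧ IsNontrivialSelfCompression G f

lemma hamiltonian_pow_add_pow_apply (v w z : Fin 2 → k) (n : ℕ) (i : Fin 2) :
    eval z (hamiltonian (linearForm v ^ (n + 1) + linearForm w ^ (n + 1)) i) =
      (n + 1) * (eval z (linearForm v) ^ n * v i + eval z (linearForm w) ^ n * w i) := by
  have h1 : ∀ u : Fin 2 → k, pderiv 1 (linearForm u) = C (u 0) := by
    intro u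
    simp [linearForm, pderiv_X]
  have h0 : ∀ u : Fin 2 → k, pderiv 0 (linearForm u) = -C (u 1) := by
    intro u
    simp [linearForm, pderiv_X]
  fin_cases i
  · simp [hamiltonian, h1]
    ring
  · simp [hamiltonian, h0]
    ring

lemma exists_eigenvalue {G : Subgroup (PSL2 k)} {A : SL2 k} (hA : A ∈ binaryGroup G) {v : Fin 2 → k} (hv : v ≠ 0)
    (hAp : A • Projectivization.mk k v hv = Projectivization.mk k v hv) {n : ℕ}
    (hn : 2 * Nat.card (stabilizer G (Projectivization.mk k v hv)) ∣ n) :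
    ∃ c : k, c ^ n = 1 ∧ A • v = c • v := by
  obtain ⟨c, hc⟩ := (smul_mk_eq_iff hv).1 hAp
  refine ⟨c, ?_, hc⟩
  obtain ⟨m, rfl⟩ := hn
  rw [pow_mul, eigenvalue_pow_eq_one hv hc (pow_card_stabilizer_eq_one hA hAp), one_pow]

variable [IsAlgClosed k] [CharZero k]

lemma HasInvariant.hasCompression {G : Subgroup (PSL2 k)} {d : ℕ} (h : HasInvariant G (d + 1)) (hd : d ≠ 0)
    (hG : ∀ p : P1 k, 3 ≤ (orbit G p).ncard) : HasCompression G d := by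
  obtain ⟨f, hf0, hf, hinv⟩ := h
  exact compression_of_invariant G hG hd hf hf0 hinv

/-- If the lines spanned by two vectors are fixed or interchanged, with coefficients that are roots
of unity of order `n + 1`, then the sum of the powers of the corresponding linear forms is an
invariant without multiple factors. -/
lemma hasCompression_of_pair {G : Subgroup (PSL2 k)} {v w : Fin 2 → k} (hvw : v 0 * w 1 - v 1 * w 0 ≠ 0) {n : ℕ}
    (hn : 2 ≤ n) (hA : ∀ A ∈ binaryGroup G, ∃ b c : k, b ^ (n + 1) = 1 ∧ c ^ (n + 1) = 1 ∧
      (A • v = b • v ∧ A • w = c • w ∨ A • v = b • w ∧ A • w = c • v)) :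
    HasCompression G n := by
  have hinf : Infinite k := IsAlgClosed.instInfinite
  set f := linearForm v ^ (n + 1) + linearForm w ^ (n + 1) with hf
  have hpow : ∀ (c : k) (u : Fin 2 → k), c ^ (n + 1) = 1 →
      linearForm (c • u) ^ (n + 1) = linearForm u ^ (n + 1) := by
    intro c u hc
    rw [linearForm_smul, mul_pow, ← C_pow, hc, C_1, one_mul]
  have hinv : ∀ A ∈ binaryGroup G, subst A f = f := by
    intro A hAG
    -- Substitution by A moves the zero of a linear form by A⁻¹.
    obtain ⟨b, c, hb, hc, ⟨h1, h2⟩ | ⟨h1, h2⟩⟩ := hA A⁻¹ (inv_mem hAG)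
    · rw [hf, map_add, map_pow, map_pow, subst_linearForm, subst_linearForm, h1, h2, hpow b v hb,
        hpow c w hc]
    · rw [hf, map_add, map_pow, map_pow, subst_linearForm, subst_linearForm, h1, h2, hpow b w hb,
        hpow c v hc, add_comm]
  have hhom : f.IsHomogeneous (n + 1) := by
    have h : ∀ u : Fin 2 → k, (linearForm u ^ (n + 1)).IsHomogeneous (n + 1) := fun u => by
      simpa using (linearForm_isHomogeneous u).pow (n + 1)
    exact (h v).add (h w)
  have hF := hamiltonian_isHomogeneous hhom
  refine ⟨hamiltonian f, compression_of_factorization G hF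
    (fun g hg z => polyMap_hamiltonian_smul (hinv g hg) z) (P := 1) (F₀ := hamiltonian f) ?_ hF hn
    (by lia) (isHomogeneous_one _ _) one_ne_zero fun i => (one_mul _).symm⟩
  -- The partial derivatives have no common zero, so the common factor can be taken to be 1: by
  -- Cramer's rule both linear forms vanish at z, and they are independent.
  intro z hz h0
  have hn1 : (n : k) + 1 ≠ 0 := by exact_mod_cast n.succ_ne_zero
  have hcoord : ∀ i, eval z (linearForm v) ^ n * v i + eval z (linearForm w) ^ n * w i = 0 := by
    intro i
    have := congrFun h0 i
    rw [polyMap, hf, hamiltonian_pow_add_pow_apply] at this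
    exact (mul_eq_zero.1 this).resolve_left hn1
  have hw : eval z (linearForm w) = 0 := by
    apply eq_zero_of_pow_eq_zero (n := n)
    apply (mul_eq_zero.1 (?_ : _ * (v 0 * w 1 - v 1 * w 0) = 0)).resolve_right hvw
    linear_combination v 0 * hcoord 1 - v 1 * hcoord 0
  have hv : eval z (linearForm v) = 0 := by
    apply eq_zero_of_pow_eq_zero (n := n)
    apply (mul_eq_zero.1 (?_ : _ * (v 0 * w 1 - v 1 * w 0) = 0)).resolve_right hvw
    linear_combination w 1 * hcoord 0 - w 0 * hcoord 1
  rw [eval_linearForm] at hv hw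
  apply hz
  ext i
  apply (mul_eq_zero.1 (?_ : _ * (v 0 * w 1 - v 1 * w 0) = 0)).resolve_right hvw
  revert i
  rw [Fin.forall_fin_two]
  constructor
  · linear_combination w 0 * hv - v 0 * hw
  · linear_combination w 1 * hv - v 1 * hw

/-- The points whose stabilizers have orders in `E` give an invariant form, under divisibility
conditions on the number of these points. -/
lemma hasInvariant_of_ncard (G : Subgroup (PSL2 k)) [Finite G] [Nontrivial G] (E : Set ℕ)
    {c : ℕ} (m : ℕ) (hc0 : c ≠ 0) (hc : {p : P1 k | Nat.card (stabilizer G p) ∈ E}.ncard = c)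
    (hin : ∀ p : P1 k, stabilizer G p ≠ ⊥ → Nat.card (stabilizer G p) ∈ E →
      2 * Nat.card (stabilizer G p) ∣ m * (c - 2))
    (hout : ∀ p : P1 k, stabilizer G p ≠ ⊥ → Nat.card (stabilizer G p) ∉ E →
      2 * Nat.card (stabilizer G p) ∣ m * c) : HasInvariant G (c * m) := by
  have hfin := Set.finite_of_ncard_ne_zero (hc.trans_ne hc0)
  have hcard : hfin.toFinset.card = c := by rw [← Set.ncard_eq_toFinset_card _ hfin, hc]
  have hO : ∀ p : P1 k, p ∈ hfin.toFinset ↔ Nat.card (stabilizer G p) ∈ E := fun p => by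
    rw [Set.Finite.mem_toFinset, Set.mem_ofPred]
  refine ⟨pointsForm hfin.toFinset ^ m, pow_ne_zero m (pointsForm_ne_zero _), ?_, ?_⟩
  · rw [← hcard]
    exact (pointsForm_isHomogeneous _).pow m
  · refine subst_pointsForm_pow G hO (fun p hp hne => ?_) (fun p hp hne => ?_)
    · rw [hcard]
      exact hin p hne ((hO p).1 hp)
    · rw [hcard]
      exact hout p hne fun h => hp ((hO p).2 h)

lemma hasInvariant_of_pointsOfOrder {G : Subgroup (PSL2 k)} [Finite G] [Nontrivial G]
    {N e n₂ n₃ nₑ : ℕ} (h : IsPolyhedralAction G (P1 k) N e n₂ n₃ nₑ) {i c : ℕ} (m : ℕ)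
    (hc0 : c ≠ 0) (hc : (pointsOfOrder G (P1 k) i).ncard = c)
    (hdvd : ∀ j, j = 2 ∨ j = 3 ∨ j = e → 2 * j ∣ m * (if j = i then c - 2 else c)) :
    HasInvariant G (c * m) := by
  have hst : ∀ p : P1 k, stabilizer G p ≠ ⊥ → Nat.card (stabilizer G p) = 2 ∨
      Nat.card (stabilizer G p) = 3 ∨ Nat.card (stabilizer G p) = e := by
    intro p hp
    exact (h.card_stabilizer p).resolve_left fun h1 => hp (Subgroup.eq_bot_of_card_eq _ h1)
  refine hasInvariant_of_ncard G {i} m hc0 hc (fun p hne hp => ?_) fun p hne hp => ?_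
  · have := hdvd _ (hst p hne)
    rwa [if_pos (Set.mem_singleton_iff.1 hp)] at this
  · have := hdvd _ (hst p hne)
    rwa [if_neg (mt Set.mem_singleton_iff.2 hp)] at this

variable {G : Subgroup (PSL2 k)} [Finite G] [Nontrivial G]

/-- The eight points of order three fill two orbits and are taken together. In degree 12 = 6a − 6
the square of the form of degree 6 is enough. -/
lemma hasInvariant_tetrahedral (h : IsPolyhedralAction G (P1 k) 12 3 6 8 8) :
    HasInvariant G 6 ∧ HasInvariant G 8 ∧ HasInvariant G 12 := by
  have h6 : HasInvariant G (6 * 1) := hasInvariant_of_pointsOfOrder h 1 (by lia) h.ncard_two (by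
    rintro j (rfl | rfl | rfl) <;> decide)
  have h8 : HasInvariant G (8 * 1) := hasInvariant_of_pointsOfOrder h 1 (by lia) h.ncard_three (by
    rintro j (rfl | rfl | rfl) <;> decide)
  exact ⟨h6, h8, h6.add h6⟩

/-- The divisibility test fails for the 6 points of order four and for the 12 points of order two
taken separately. The square of the first form gives degree 12, and the product of the two gives
degree 18. -/
lemma hasInvariant_octahedral (h : IsPolyhedralAction G (P1 k) 24 4 12 8 6) :
    HasInvariant G 8 ∧ HasInvariant G 12 ∧ HasInvariant G 18 := by
  have h8 : HasInvariant G (8 * 1) := hasInvariant_of_pointsOfOrder h 1 (by lia) h.ncard_three (by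
    rintro j (rfl | rfl | rfl) <;> decide)
  have h12 : HasInvariant G (6 * 2) := hasInvariant_of_pointsOfOrder h 2 (by lia) h.ncard_top (by
    rintro j (rfl | rfl | rfl) <;> decide)
  have hU : {p : P1 k | Nat.card (stabilizer G p) ∈ ({2, 4} : Set ℕ)} =
      pointsOfOrder G (P1 k) 2 ∪ pointsOfOrder G (P1 k) 4 := rfl
  have h18 : HasInvariant G (18 * 1) := by
    refine hasInvariant_of_ncard G {2, 4} 1 (by lia) ?_ (fun p hne hp => ?_) fun p hne hp => ?_
    · have hdisj : Disjoint (pointsOfOrder G (P1 k) 2) (pointsOfOrder G (P1 k) 4) :=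
        Set.disjoint_left.2 fun p (hp : _ = 2) (hp' : _ = 4) => by lia
      rw [hU, Set.ncard_union_eq hdisj (Set.finite_of_ncard_ne_zero (by rw [h.ncard_two]; lia))
        (Set.finite_of_ncard_ne_zero (by rw [h.ncard_top]; lia)), h.ncard_two, h.ncard_top]
    · rcases hp with hp | hp <;> rw [hp] <;> decide
    · have h1 : Nat.card (stabilizer G p) ≠ 1 := fun h1 => hne (Subgroup.eq_bot_of_card_eq _ h1)
      have h2 := h.card_stabilizer p
      simp only [Set.mem_insert_iff, Set.mem_singleton_iff] at hp
      have h3 : Nat.card (stabilizer G p) = 3 := by lia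
      rw [h3]
      decide
  exact ⟨h8, h12, h18⟩

lemma hasInvariant_icosahedral (h : IsPolyhedralAction G (P1 k) 60 5 30 20 12) :
    HasInvariant G 12 ∧ HasInvariant G 20 ∧ HasInvariant G 30 := by
  have h12 : HasInvariant G (12 * 1) := hasInvariant_of_pointsOfOrder h 1 (by lia) h.ncard_top (by
    rintro j (rfl | rfl | rfl) <;> decide)
  have h20 : HasInvariant G (20 * 1) := hasInvariant_of_pointsOfOrder h 1 (by lia)
    h.ncard_three (by rintro j (rfl | rfl | rfl) <;> decide)
  have h30 : HasInvariant G (30 * 1) := hasInvariant_of_pointsOfOrder h 1 (by lia) h.ncard_two (by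
    rintro j (rfl | rfl | rfl) <;> decide)
  exact ⟨h12, h20, h30⟩

/-- The second fixed point of a nontrivial element has the same stabilizer, so G fixes two points,
with eigenvalues that are 2|G|-th roots of unity. -/
lemma hasCompression_of_fixed {p : P1 k} (hp : stabilizer G p = ⊤) {n : ℕ} (hn : 2 ≤ n)
    (hdvd : 2 * Nat.card G ∣ n + 1) : HasCompression G n := by
  have h := hasTwoFixedPoints G
  obtain ⟨g, hg⟩ := exists_ne (1 : G)
  have hfix : ∀ {r : P1 k}, stabilizer G r = ⊤ → ∀ A ∈ binaryGroup G, A • r = r := by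
    intro r hr A hA
    have : (⟨QuotientGroup.mk A, hA⟩ : G) ∈ stabilizer G r := by rw [hr]; trivial
    exact this
  have hgp : g • p = p := by
    have : g ∈ stabilizer G p := by rw [hp]; trivial
    exact this
  obtain ⟨q, hq, hqp⟩ : ∃ q ∈ fixedBy (P1 k) g, q ≠ p :=
    Set.exists_ne_of_one_lt_ncard (by rw [h.ncard_fixedBy g hg]; lia) p
  have hst : stabilizer G q = ⊤ := by rw [h.stabilizer_eq hg hq hgp, hp]
  have hne := wedge_ne_zero_of_mk_ne p.rep_nonzero q.rep_nonzero (by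
    rw [p.mk_rep, q.mk_rep]
    exact hqp.symm)
  refine hasCompression_of_pair hne hn fun A hA => ?_
  obtain ⟨b, hb, hbv⟩ := exists_eigenvalue (n := n + 1) hA p.rep_nonzero
    (by rw [p.mk_rep, hfix hp A hA]) (by rwa [p.mk_rep, hp, Subgroup.card_top])
  obtain ⟨c, hc, hcv⟩ := exists_eigenvalue (n := n + 1) hA q.rep_nonzero
    (by rw [q.mk_rep, hfix hst A hA]) (by rwa [q.mk_rep, hst, Subgroup.card_top])
  exact ⟨b, c, hb, hc, Or.inl ⟨hbv, hcv⟩⟩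

omit [Nontrivial G] in
lemma hasCompression_of_orbit_two {p : P1 k} (hp : 2 ≤ Nat.card (stabilizer G p))
    (horb : (orbit G p).ncard = 2) {n : ℕ} (hn : 2 ≤ n)
    (hdvd : 2 * Nat.card (stabilizer G p) ∣ n + 1) : HasCompression G n := by
  have h := hasTwoFixedPoints G
  have hindex : (stabilizer G p).index = 2 := by rw [index_stabilizer, horb]
  obtain ⟨g, hg⟩ : ∃ g : G, g ∉ stabilizer G p := by
    by_contra! h0
    rw [(Subgroup.eq_top_iff' _).2 h0, Subgroup.index_top] at hindex
    lia
  obtain ⟨hst, -, -⟩ := h.orbit_two horb hp g hg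
  obtain ⟨g, hgG⟩ := g
  obtain ⟨B, rfl⟩ := QuotientGroup.mk_surjective g
  have hB : B ∈ binaryGroup G := hgG
  induction p using Projectivization.ind with | _ v hv
  set p := Projectivization.mk k v hv with hpdef
  have hmul : ∀ {A A' : SL2 k}, A ∈ binaryGroup G → A' ∈ binaryGroup G →
      ((A * A') • p = p ↔ (A • p = p ↔ A' • p = p)) := fun hA hA' =>
    Subgroup.mul_mem_iff_of_index_two hindex (a := ⟨QuotientGroup.mk _, hA⟩)
      (b := ⟨QuotientGroup.mk _, hA'⟩)
  have hBp : B • p ≠ p := hg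
  have hBp' : B⁻¹ • p ≠ p := fun h0 => hBp (inv_smul_eq_iff.1 h0).symm
  have hw : B • v ≠ 0 := (smul_ne_zero_iff_ne B).2 hv
  have hq : Projectivization.mk k (B • v) hw = B • p := by
    rw [hpdef, Projectivization.smul_mk B hv]
  have hstq : stabilizer G (Projectivization.mk k (B • v) hw) = stabilizer G p := by
    rw [hq]
    exact hst
  have hne := wedge_ne_zero_of_mk_ne hv hw (by
    rw [hq]
    exact hBp.symm)
  refine hasCompression_of_pair hne hn fun A hA => ?_
  by_cases hAp : A • p = p
  · have hAq : A • Projectivization.mk k (B • v) hw = Projectivization.mk k (B • v) hw := by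
      have : (⟨QuotientGroup.mk A, hA⟩ : G) ∈
          stabilizer G (Projectivization.mk k (B • v) hw) := by
        rw [hstq]
        exact hAp
      exact this
    obtain ⟨b, hb, hbv⟩ := exists_eigenvalue (n := n + 1) hA hv hAp hdvd
    obtain ⟨c, hc, hcv⟩ := exists_eigenvalue (n := n + 1) hA hw hAq (by rwa [hstq])
    exact ⟨b, c, hb, hc, Or.inl ⟨hbv, hcv⟩⟩
  -- A interchanges the lines of v and Bv. The stabilizer has index two, so B⁻¹A and AB fix p, and
  -- their eigenvalues at v are the two coefficients.
  · obtain ⟨b, hb, hbv⟩ := exists_eigenvalue (n := n + 1) (mul_mem (inv_mem hB) hA) hv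
      ((hmul (inv_mem hB) hA).2 (by tauto)) hdvd
    obtain ⟨c, hc, hcv⟩ := exists_eigenvalue (n := n + 1) (mul_mem hA hB) hv
      ((hmul hA hB).2 (by tauto)) hdvd
    refine ⟨b, c, hb, hc, Or.inr ⟨?_, ?_⟩⟩
    · rw [mul_smul, inv_smul_eq_iff, smul_comm] at hbv
      exact hbv
    · rwa [mul_smul] at hcv

end Invariants
end CremonaOne

namespace CremonaOne
open MulAction

/-! ### Supports of the power series. -/

section Series

lemma exists_of_coeff_powerSum_ne_zero {e : ℕ → ℕ} {d : ℕ}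
    (h : PowerSeries.coeff d (powerSum e) ≠ 0) : ∃ n, e n = d := by
  rw [powerSum, PowerSeries.coeff_mk] at h
  exact Set.nonempty_of_ncard_ne_zero (Int.natCast_ne_zero.1 h)

lemma coeff_powerSum_nonneg (e : ℕ → ℕ) (d : ℕ) : 0 ≤ PowerSeries.coeff d (powerSum e) := by
  rw [powerSum, PowerSeries.coeff_mk]
  exact Int.natCast_nonneg _

lemma coeff_powerSum_pos {e : ℕ → ℕ} (he : Function.Injective e) (n : ℕ) :
    0 < PowerSeries.coeff (e n) (powerSum e) := by
  rw [powerSum, PowerSeries.coeff_mk,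
    show {m | e m = e n} = {n} from Set.ext fun m => he.eq_iff, Set.ncard_singleton]
  exact one_pos

lemma exists_of_coeff_mul_ne_zero {φ ψ : PowerSeries ℤ} {d : ℕ}
    (h : PowerSeries.coeff d (φ * ψ) ≠ 0) :
    ∃ i j, i + j = d ∧ PowerSeries.coeff i φ ≠ 0 ∧ PowerSeries.coeff j ψ ≠ 0 := by
  rw [PowerSeries.coeff_mul] at h
  obtain ⟨⟨i, j⟩, hij, h⟩ := Finset.exists_ne_zero_of_sum_ne_zero h
  exact ⟨i, j, Finset.HasAntidiagonal.mem_antidiagonal.1 hij, left_ne_zero_of_mul h, right_ne_zero_of_mul h⟩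

lemma eq_of_coeff_X_pow_ne_zero {d n : ℕ}
    (h : PowerSeries.coeff d (PowerSeries.X ^ n : PowerSeries ℤ) ≠ 0) : d = n := by
  by_contra hd
  rw [PowerSeries.coeff_X_pow, if_neg hd] at h
  exact h rfl

lemma coeff_mul_nonneg {φ ψ : PowerSeries ℤ} (hφ : ∀ d, 0 ≤ PowerSeries.coeff d φ)
    (hψ : ∀ d, 0 ≤ PowerSeries.coeff d ψ) (d : ℕ) : 0 ≤ PowerSeries.coeff d (φ * ψ) := by
  rw [PowerSeries.coeff_mul]
  exact Finset.sum_nonneg fun p _ => mul_nonneg (hφ _) (hψ _)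

lemma coeff_X_pow_nonneg (n d : ℕ) :
    0 ≤ PowerSeries.coeff d (PowerSeries.X ^ n : PowerSeries ℤ) := by
  rw [PowerSeries.coeff_X_pow]
  split <;> simp

lemma exists_of_coeff_dihedralSeries_ne_zero {l d : ℕ}
    (h : PowerSeries.coeff d (dihedralSeries l) ≠ 0) : ∃ n, 2 * l * (n + 1) - 1 = d :=
  exists_of_coeff_powerSum_ne_zero h

lemma infinite_coeff_dihedralSeries {l : ℕ} (hl : 2 ≤ l) :
    {d | PowerSeries.coeff d (dihedralSeries l) ≠ 0}.Infinite := by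
  have hinj : Function.Injective fun n => 2 * l * (n + 1) - 1 := by
    intro m n h
    have h1 : ∀ i, 0 < 2 * l * (i + 1) := fun i => by positivity
    have h2 : 2 * l * (m + 1) = 2 * l * (n + 1) := by
      have := h1 m
      have := h1 n
      dsimp only at h
      lia
    have := Nat.eq_of_mul_eq_mul_left (by lia) h2
    lia
  exact Set.infinite_of_injective_forall_mem hinj fun n => (coeff_powerSum_pos hinj n).ne'

/-- Only the support matters. In terms of d + 1 the alternatives start at 2a, 6a − 6 and 4a − 4; the
first two allow further multiples of 2a, and all three allow multiples of 4a − 4. -/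
lemma exists_of_coeff_polyhedralSeries_ne_zero {a d : ℕ}
    (h : PowerSeries.coeff d (polyhedralSeries a) ≠ 0) :
    ∃ m n, d = 2 * a - 1 + 2 * n * a + (4 * a - 4) * m ∨
      d = 2 * a - 1 + (4 * a - 6) + 2 * n * a + (4 * a - 4) * m ∨
      d = 4 * a - 5 + (4 * a - 4) * m := by
  rw [polyhedralSeries, map_add] at h
  by_cases h1 : PowerSeries.coeff d (PowerSeries.X ^ (4 * a - 5) *
      powerSum (fun n => (4 * a - 4) * n)) = 0
  · rw [h1, add_zero] at h
    obtain ⟨i, j, hij, hi, hj⟩ := exists_of_coeff_mul_ne_zero h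
    obtain ⟨m, hm⟩ := exists_of_coeff_powerSum_ne_zero hj
    obtain ⟨r, s, hrs, hr, hs⟩ := exists_of_coeff_mul_ne_zero hi
    obtain ⟨n, hn⟩ := exists_of_coeff_powerSum_ne_zero hs
    obtain ⟨t, u, htu, ht, hu⟩ := exists_of_coeff_mul_ne_zero hr
    have ht' := eq_of_coeff_X_pow_ne_zero ht
    have hu' : u = 0 ∨ u = 4 * a - 6 := by
      by_contra! h0
      rw [map_add, PowerSeries.coeff_one, if_neg h0.1, PowerSeries.coeff_X_pow, if_neg h0.2] at hu
      exact hu rfl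
    refine ⟨m, n, ?_⟩
    rcases hu' with rfl | rfl
    · left
      lia
    · right; left
      lia
  · obtain ⟨i, j, hij, hi, hj⟩ := exists_of_coeff_mul_ne_zero h1
    obtain ⟨m, hm⟩ := exists_of_coeff_powerSum_ne_zero hj
    have hi' := eq_of_coeff_X_pow_ne_zero hi
    exact ⟨m, 0, Or.inr (Or.inr (by lia))⟩

/-- All coefficients are nonnegative, so nothing cancels the infinitely many exponents of the last
summand. -/
lemma infinite_coeff_polyhedralSeries {a : ℕ} (ha : 2 ≤ a) :
    {d | PowerSeries.coeff d (polyhedralSeries a) ≠ 0}.Infinite := by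
  have hinj : Function.Injective fun n => (4 * a - 4) * n :=
    fun m n h => Nat.eq_of_mul_eq_mul_left (by lia) h
  refine Set.infinite_of_injective_forall_mem (f := fun n => (4 * a - 4) * n + (4 * a - 5))
    (fun m n h => hinj (Nat.add_right_cancel h)) fun n => ?_
  refine ne_of_gt ?_
  rw [polyhedralSeries, map_add, PowerSeries.coeff_X_pow_mul]
  refine add_pos_of_nonneg_of_pos ?_ (coeff_powerSum_pos hinj n)
  refine coeff_mul_nonneg (coeff_mul_nonneg (coeff_mul_nonneg (coeff_X_pow_nonneg _) fun d => ?_)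
    (coeff_powerSum_nonneg _)) (coeff_powerSum_nonneg _) _
  rw [map_add, ← pow_zero PowerSeries.X]
  exact add_nonneg (coeff_X_pow_nonneg _ _) (coeff_X_pow_nonneg _ _)

end Series

/-! ### The series depends only on the isomorphism type. -/

section Uniqueness

/-- The group has an element generating a subgroup of index at most two. -/
def HasLargeElement (G : Type*) [Group G] : Prop :=
  ∃ g : G, Nat.card G ≤ 2 * orderOf g

lemma HasLargeElement.of_mulEquiv {G H : Type*} [Group G] [Group H] (e : G ≃* H)
    (h : HasLargeElement G) : HasLargeElement H := by
  obtain ⟨g, hg⟩ := h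
  exact ⟨e g, by rwa [e.orderOf_eq, ← Nat.card_congr e.toEquiv]⟩

lemma orderOf_le_of_pow_eq_one_of_le {M : Type*} [Monoid M] {x : M} {n N : ℕ} (hn : 0 < n)
    (hnN : n ≤ N) (hx : x ^ n = 1) : orderOf x ≤ N :=
  (orderOf_le_of_pow_eq_one hn hx).trans hnN

lemma natCard_alternatingGroup_four : Nat.card (alternatingGroup (Fin 4)) = 12 := by
  rw [nat_card_alternatingGroup, Nat.card_fin]
  rfl

lemma natCard_perm_four : Nat.card (Equiv.Perm (Fin 4)) = 24 := by
  rw [Nat.card_perm, Nat.card_fin]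
  rfl

lemma natCard_alternatingGroup_five : Nat.card (alternatingGroup (Fin 5)) = 60 := by
  rw [nat_card_alternatingGroup, Nat.card_fin]
  rfl

lemma not_hasLargeElement_alternatingGroup_four :
    ¬ HasLargeElement (alternatingGroup (Fin 4)) := by
  have key : ∀ g : alternatingGroup (Fin 4), g ^ 2 = 1 ∨ g ^ 3 = 1 := by decide +kernel
  rintro ⟨g, hg⟩
  rw [natCard_alternatingGroup_four] at hg
  have : orderOf g ≤ 3 := by
    rcases key g with h | h <;> exact orderOf_le_of_pow_eq_one_of_le (by lia) (by lia) h
  lia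

lemma not_hasLargeElement_perm_four : ¬ HasLargeElement (Equiv.Perm (Fin 4)) := by
  have key : ∀ g : Equiv.Perm (Fin 4), g ^ 3 = 1 ∨ g ^ 4 = 1 := by decide +kernel
  rintro ⟨g, hg⟩
  rw [natCard_perm_four] at hg
  have : orderOf g ≤ 4 := by
    rcases key g with h | h <;> exact orderOf_le_of_pow_eq_one_of_le (by lia) (by lia) h
  lia

lemma not_hasLargeElement_alternatingGroup_five :
    ¬ HasLargeElement (alternatingGroup (Fin 5)) := by
  have key : ∀ g : alternatingGroup (Fin 5), g ^ 2 = 1 ∨ g ^ 3 = 1 ∨ g ^ 5 = 1 := by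
    decide +kernel
  rintro ⟨g, hg⟩
  rw [natCard_alternatingGroup_five] at hg
  have : orderOf g ≤ 5 := by
    rcases key g with h | h | h <;> exact orderOf_le_of_pow_eq_one_of_le (by lia) (by lia) h
  lia

lemma hasLargeElement_dihedralGroup (l : ℕ) : HasLargeElement (DihedralGroup l) :=
  ⟨DihedralGroup.r 1, by rw [DihedralGroup.nat_card, DihedralGroup.orderOf_r_one]⟩

lemma hasLargeElement_of_isCyclic (G : Type*) [Group G] [IsCyclic G] : HasLargeElement G := by
  obtain ⟨g, hg⟩ := IsCyclic.exists_ofOrder_eq_natCard (α := G)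
  exact ⟨g, by lia⟩

open scoped Classical in
/-- The power series of a group in terms of its order, of the orders of its elements and of
cyclicity. -/
noncomputable def seriesOf (G : Type*) [Group G] : PowerSeries ℤ :=
  if HasLargeElement G then dihedralSeries (if IsCyclic G then Nat.card G else Nat.card G / 2)
  else polyhedralSeries (if Nat.card G = 12 then 3 else if Nat.card G = 24 then 4 else 6)

/-- A large element separates cyclic and dihedral groups from polyhedral ones; within each family,
cyclicity or the order decides. All types thus agree with one function of the group, which gives
uniqueness. -/
lemma IsSeriesOf.eq_seriesOf {H : Type*} [Group H] {G : Subgroup H} {S : PowerSeries ℤ}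
    (h : IsSeriesOf G S) : S = seriesOf G := by
  cases h with
  | tetrahedral h =>
    obtain ⟨e⟩ := h
    rw [seriesOf, if_neg fun h => not_hasLargeElement_alternatingGroup_four (h.of_mulEquiv e),
      Nat.card_congr e.toEquiv, natCard_alternatingGroup_four]
    rfl
  | octahedral h =>
    obtain ⟨e⟩ := h
    rw [seriesOf, if_neg fun h => not_hasLargeElement_perm_four (h.of_mulEquiv e),
      Nat.card_congr e.toEquiv, natCard_perm_four]
    rfl
  | icosahedral h =>
    obtain ⟨e⟩ := h
    rw [seriesOf, if_neg fun h => not_hasLargeElement_alternatingGroup_five (h.of_mulEquiv e),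
      Nat.card_congr e.toEquiv, natCard_alternatingGroup_five]
    rfl
  | dihedral l hl h =>
    obtain ⟨e⟩ := h
    rw [seriesOf, if_pos ((hasLargeElement_dihedralGroup l).of_mulEquiv e.symm),
      if_neg fun h => DihedralGroup.not_isCyclic (by lia) (e.isCyclic.1 h),
      Nat.card_congr e.toEquiv, DihedralGroup.nat_card, Nat.mul_div_cancel_left l two_pos]
  | cyclic l hl h hcard =>
    rw [seriesOf, if_pos (hasLargeElement_of_isCyclic G), if_pos h, hcard]

end Uniqueness

/-! ### Assembling the types, the series and the compressions. -/

section Existence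

variable {k : Type*} [Field k] [IsAlgClosed k] [CharZero k] {G : Subgroup (PSL2 k)} [Finite G]
  [Nontrivial G]

-- The three degrees are 6, 8, 12 for a = 3, then 8, 12, 18 for a = 4, and 12, 20, 30 for a = 6.
-- Products of these invariants reach every required degree d + 1.
omit [Finite G] [Nontrivial G] in
lemma hasCompression_of_coeff_polyhedralSeries {a N e n₂ n₃ nₑ : ℕ} (ha : 3 ≤ a)
    (hN : 2 * e < N) (he : 3 ≤ e) (h : IsPolyhedralAction G (P1 k) N e n₂ n₃ nₑ)
    (h1 : HasInvariant G (2 * a)) (h2 : HasInvariant G (4 * a - 4))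
    (h3 : HasInvariant G (6 * a - 6)) {d : ℕ}
    (hd : PowerSeries.coeff d (polyhedralSeries a) ≠ 0) : HasCompression G d := by
  have horb := h.three_le_ncard_orbit hN he
  obtain ⟨m, n, hd | hd | hd⟩ := exists_of_coeff_polyhedralSeries_ne_zero hd
  · refine HasInvariant.hasCompression ?_ (by lia) horb
    convert (h1.add (h1.mul_right n)).add (h2.mul_right m) using 1
    have : 2 * a * n = 2 * n * a := by ring
    lia
  · refine HasInvariant.hasCompression ?_ (by lia) horb
    convert (h3.add (h1.mul_right n)).add (h2.mul_right m) using 1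
    have : 2 * a * n = 2 * n * a := by ring
    lia
  · refine HasInvariant.hasCompression ?_ (by lia) horb
    convert h2.add (h2.mul_right m) using 1
    lia

variable (G) in
theorem exists_series : ∃ S : PowerSeries ℤ, IsSeriesOf G S ∧
    {d : ℕ | PowerSeries.coeff d S ≠ 0}.Infinite ∧
    ∀ d : ℕ, PowerSeries.coeff d S ≠ 0 → HasCompression G d := by
  have h := hasTwoFixedPoints G
  have hN : 2 ≤ Nat.card G := Finite.one_lt_card
  have hdeg : ∀ {l n : ℕ}, 2 ≤ l → 2 ≤ 2 * l * (n + 1) - 1 ∧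
      2 * l * (n + 1) - 1 + 1 = 2 * l * (n + 1) := by
    intro l n hl
    have : 4 * 1 ≤ 2 * l * (n + 1) := Nat.mul_le_mul (by lia) (by lia)
    lia
  rcases h.classification with ⟨p, hp⟩ | ⟨p, hst, horb⟩ | hG | hG | hG
  · have hcyc : IsCyclic G := by
      have := h.isCyclic_stabilizer p
      rw [hp] at this
      exact Subgroup.topEquiv.isCyclic.1 this
    refine ⟨_, .cyclic _ hN hcyc rfl, infinite_coeff_dihedralSeries hN, fun d hd => ?_⟩
    obtain ⟨n, rfl⟩ := exists_of_coeff_dihedralSeries_ne_zero hd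
    exact hasCompression_of_fixed hp (hdeg hN).1 ⟨n + 1, (hdeg hN).2⟩
  · have := h.isCyclic_stabilizer p
    refine ⟨_, .dihedral _ hst (nonempty_mulEquiv_dihedralGroup (by rw [index_stabilizer, horb])
      fun g hg => (h.orbit_two horb hst g hg).2.2), infinite_coeff_dihedralSeries hst,
      fun d hd => ?_⟩
    obtain ⟨n, rfl⟩ := exists_of_coeff_dihedralSeries_ne_zero hd
    exact hasCompression_of_orbit_two hst horb (hdeg hst).1 ⟨n + 1, (hdeg hst).2⟩
  · obtain ⟨hS, hinj⟩ := h.sylow_three (Or.inl rfl) hG.card_eq (by rw [hG.ncard_three]; lia)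
      fun p => by have := hG.card_stabilizer p; lia
    obtain ⟨h1, h2, h3⟩ := hasInvariant_tetrahedral hG
    exact ⟨_, .tetrahedral (nonempty_mulEquiv_alternatingGroup hS hinj (by rw [hG.card_eq]; rfl)),
      infinite_coeff_polyhedralSeries (by lia), fun d hd =>
      hasCompression_of_coeff_polyhedralSeries (by lia) (by lia) (by lia) hG h1 h2 h3 hd⟩
  · obtain ⟨hS, hinj⟩ := h.sylow_three (Or.inr rfl) hG.card_eq (by rw [hG.ncard_three]; lia)
      fun p => by have := hG.card_stabilizer p; lia
    obtain ⟨h1, h2, h3⟩ := hasInvariant_octahedral hG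
    exact ⟨_, .octahedral (nonempty_mulEquiv_perm hS hinj (by rw [hG.card_eq]; rfl)),
      infinite_coeff_polyhedralSeries (by lia), fun d hd =>
      hasCompression_of_coeff_polyhedralSeries (by lia) (by lia) (by lia) hG h1 h2 h3 hd⟩
  · obtain ⟨hS, hinj⟩ := h.sylow_two hG
    obtain ⟨h1, h2, h3⟩ := hasInvariant_icosahedral hG
    exact ⟨_, .icosahedral (nonempty_mulEquiv_alternatingGroup hS hinj (by rw [hG.card_eq]; rfl)),
      infinite_coeff_polyhedralSeries (by lia), fun d hd =>
      hasCompression_of_coeff_polyhedralSeries (by lia) (by lia) (by lia) hG h1 h2 h3 hd⟩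

end Existence
end CremonaOne

theorem mainTheorem1 {k : Type*} [Field k] [IsAlgClosed k] [CharZero k]
    (G : Subgroup (CremonaOne.PSL2 k)) [Finite G] (hG : G ≠ ⊥) :
    (∃! S : PowerSeries ℤ, CremonaOne.IsSeriesOf G S) ∧
    ∀ S : PowerSeries ℤ, CremonaOne.IsSeriesOf G S →
      {d : ℕ | PowerSeries.coeff d S ≠ 0}.Infinite ∧
      ∀ d : ℕ, PowerSeries.coeff d S ≠ 0 →
        ∃ F : Fin 2 → MvPolynomial (Fin 2) k,
          CremonaOne.IsHomogeneousSelfCompression (CremonaOne.binaryGroup G) d F ∧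
          ∃ f : CremonaOne.P1 k → CremonaOne.P1 k,
            CremonaOne.IsDescent F f ∧ CremonaOne.IsNontrivialSelfCompression G f := by
  have := (Subgroup.nontrivial_iff_ne_bot G).2 hG
  obtain ⟨S, hS, hinf, hcomp⟩ := CremonaOne.exists_series G
  refine ⟨⟨S, hS, fun T hT => hT.eq_seriesOf.trans hS.eq_seriesOf.symm⟩, fun T hT => ?_⟩
  obtain rfl : T = S := hT.eq_seriesOf.trans hS.eq_seriesOf.symm
  exact ⟨hinf, hcomp⟩
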